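/- Let $(\Omega,\mathcal F,P)$ be a probability space, $B\ge 0$, $X:\Omega\to[-B,B]$ measurable, $\tau>0$, and let $\phi:\mathbb R\to[0,+\infty]$ be any divergence function, i.e. convex and lower semicontinuous with $\phi(1)=0$ and $\phi(x)=+\infty$ for $x<0$ (no growth assumption). For a probability measure $Q$ on $(\Omega,\mathcal F)$ put $$\mathcal R^{\phi,Q}(X)=\sup\Big\{\int X\zeta\,dQ:\ \zeta\ge 0\text{ measurable},\ \int\zeta\,dQ=1,\ \int\phi(\zeta)\,dQ\le\tau\Big\}.$$ Write $\mathcal R(X)=\mathcal R^{\phi,P}(X)$; for $n\ge1$ i.i.d. samples from $P$ with empirical distribution $P_n$ write $\mathcal R_n(X)=\mathcal R^{\phi,P_n}(X)$, and $\mathcal R_{n,L}(X)=\mathcal R^{\phi_L,P_n}(X)$, where $\phi_L=\phi$ on $[0,L]$ and $\phi_L=+\infty$ elsewhere. Let $\epsilon>0$ and let $\zeta^*_\epsilon$ be an $(\epsilon/8)$-optimal solution of the problem defining $\mathcal R(X)$, i.e. feasible with $\int X\zeta^*_\epsilon\,dP\ge\mathcal R(X)-\epsilon/8$. Let $\eta>0$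 satisfy $B\eta\le\epsilon/8$ (so one may take $\eta=\epsilon/(8B)$ if $B>0$, and also $\eta=\epsilon/8$ if $B\le1$), and set $$L(\epsilon)=\inf\{L\ge1:\ \mathbb E_P[\zeta^*_\epsilon-L]_+\le\eta\},\qquad \underline\lambda(\epsilon)=\frac{\epsilon}{8\tau},$$ $$\overline L(\epsilon)=L(\epsilon)+1+\frac{2(1+L(\epsilon))B}{\underline\lambda(\epsilon)}+\tau,\qquad M(\epsilon)=(3+2L(\epsilon))B.$$ Then, with the convention $\log 0=0$ (relevant only if $B=0$): (1) For every $\delta\in(0,1)$ and every integer $n\ge1$ with $$n\ \ge\ \frac{128\,M(\epsilon)^2\log\!\big(256B^2\overline L(\epsilon)^2/(\tau\epsilon^2\delta)\big)}{\epsilon^2},$$ with probability at least $1-\delta$ we have $|\mathcal R(X)-\mathcal R_{n,L(\epsilon)}(X)|\le\epsilon$. (2) For every integer $n\ge1$ with $$n\ \ge\ \frac{512\,M(\epsilon)^2\log\!\big(8192B^3\overline L(\epsilon)^2/(\tau\epsilon^3)\big)}{\epsilon^2},$$ $\mathcal R_n(X)$ is integrable and $$\mathcal R(X)-\epsilon\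 \le\ \mathbb E_{P^{\otimes n}}[\mathcal R_n(X)]\ \le\ \mathcal R(X).$$ -/

import Mathlib

open MeasureTheory
open scoped ENNReal NNReal

/-- A divergence function: a convex lower semicontinuous `φ : ℝ → [0, +∞]` with `φ 1 = 0` and
`φ x = +∞` for `x < 0`.  (Convexity of a `[0, +∞]`-valued function uses weights in `ℝ≥0`.) -/
structure IsDivergence (φ : ℝ → ℝ≥0∞) : Prop where
  convex : ConvexOn ℝ≥0 Set.univ φ
  lsc : LowerSemicontinuous φ
  one : φ 1 = 0
  neg : ∀ x : ℝ, x < 0 → φ x = ⊤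

/-- The truncation `φ_L`: equal to `φ` on `[0, L]` and to `+∞` elsewhere. -/
noncomputable def truncDivergence (φ : ℝ → ℝ≥0∞) (L : ℝ) : ℝ → ℝ≥0∞ :=
  open Classical in fun x => if x ∈ Set.Icc (0 : ℝ) L then φ x else ⊤

/-- `ζ` is a probability density with respect to `P`. -/
structure IsDensity {Ω : Type*} [MeasurableSpace Ω] (P : Measure Ω) (ζ : Ω → ℝ) : Prop where
  measurable : Measurable ζ
  nonneg : ∀ ω, 0 ≤ ζ ω
  lintegral_eq_one : ∫⁻ ω, ENNReal.ofReal (ζ ω) ∂P = 1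

/-- The ambiguity set: densities `ζ` with `∫ φ(ζ) dP ≤ τ`. -/
def ambiguitySet {Ω : Type*} [MeasurableSpace Ω] (φ : ℝ → ℝ≥0∞) (τ : ℝ) (P : Measure Ω) :
    Set (Ω → ℝ) :=
  {ζ | IsDensity P ζ ∧ ∫⁻ ω, φ (ζ ω) ∂P ≤ ENNReal.ofReal τ}

/-- The distributionally robust functional
`sup { ∫ X ζ dP : ζ ∈ ambiguitySet φ τ P }`.  For `P` a probability measure, `τ ≥ 0`, `X` bounded
and measurable and `φ` a divergence, this is the supremum of a nonempty bounded set of reals. -/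
noncomputable def robustRisk {Ω : Type*} [MeasurableSpace Ω] (φ : ℝ → ℝ≥0∞) (τ : ℝ)
    (P : Measure Ω) (X : Ω → ℝ) : ℝ :=
  sSup ((fun ζ : Ω → ℝ => ∫ ω, X ω * ζ ω ∂P) '' ambiguitySet φ τ P)

/-- The empirical distribution of a sample of size `n`. -/
noncomputable def empiricalDist {Ω : Type*} [MeasurableSpace Ω] {n : ℕ} (s : Fin n → Ω) :
    Measure Ω :=
  (n : ℝ≥0∞)⁻¹ • ∑ i, Measure.dirac (s i)

/-- The sample average approximation: the functional at the empirical distribution. -/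
noncomputable def empiricalRisk {Ω : Type*} [MeasurableSpace Ω] (φ : ℝ → ℝ≥0∞) (τ : ℝ)
    (X : Ω → ℝ) {n : ℕ} (s : Fin n → Ω) : ℝ :=
  robustRisk φ τ (empiricalDist s) X

/-- `ζ` is an `e`-optimal solution of the problem defining `robustRisk φ τ P X`. -/
def IsNearOptimal {Ω : Type*} [MeasurableSpace Ω] (φ : ℝ → ℝ≥0∞) (τ : ℝ)
    (P : Measure Ω) (X : Ω → ℝ) (e : ℝ) (ζ : Ω → ℝ) : Prop :=
  ζ ∈ ambiguitySet φ τ P ∧ robustRisk φ τ P X - e ≤ ∫ ω, X ω * ζ ω ∂P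

/-- The instance-dependent truncation level `inf { L ≥ 1 : E_P [ζ - L]_+ ≤ η }`. -/
noncomputable def truncLevel {Ω : Type*} [MeasurableSpace Ω] (P : Measure Ω) (ζ : Ω → ℝ)
    (η : ℝ) : ℝ :=
  sInf {L : ℝ | 1 ≤ L ∧ ∫ ω, max (ζ ω - L) 0 ∂P ≤ η}

/-- The lower bound `ε / (8τ)` for the dual multiplier. -/
noncomputable def lambdaLow (τ ε : ℝ) : ℝ := ε / (8 * τ)

/-- The constant `L + 1 + 2(1+L)B / (ε/(8τ)) + τ`. -/
noncomputable def lipConst (B τ ε L : ℝ) : ℝ :=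
  L + 1 + 2 * (1 + L) * B / lambdaLow τ ε + τ

/-- The constant `(3 + 2L)B`. -/
noncomputable def boundConst (B L : ℝ) : ℝ := (3 + 2 * L) * B

/-! ### Divergences and their truncations -/

namespace IsDivergence

variable {φ : ℝ → ℝ≥0∞}

/-! The engine is Lagrangian duality. Write `H_l(y)` for the supremum of `(z - 1) y - l φ(z)` over
the domain of `φ` (`conjExcess`). The robust risk is the minimum over `l ≥ 0`, `|μ| ≤ B` of `E[X +
H_l(X - μ)] + l τ` (`exists_dual`, with weak duality in `robustRisk_le_dual`). The multipliers come
from a Hahn–Banach separation. The bound `|μ| ≤ B` holds because violating the mass constraint is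
worth at most `B` per unit of mass: since `φ` decreases towards `1`, wrong mass is repaired by
moving `ζ` pointwise towards `1`.

The same duality holds at the empirical measure. Inserting the multipliers optimal for `P` bounds
the empirical risk by a sample mean whose expectation is at most the true risk; this is the upper
half of (2), with no truncation.

For `φ_L` the dual integrand is bounded, nonincreasing in `l` and `L`-Lipschitz in `μ`. One
Hoeffding bound at the population optimum controls the empirical risk from above. Hoeffding on a
finite grid of multipliers controls it from below, rounding `l` up and `μ` down
(`exists_concentration_event`). As `l` is only rounded upwards, no lower bound on the multiplier is
needed.

Truncating a near-optimal density at `L` costs at most `2Bη ≤ ε/4`, so the risks for `φ` and `φ_L`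
differ by at most `3ε/8`. Together with the sampling error this gives (1). The lower half of (2)
follows on taking `δ = ε/(32B)` and bounding the error crudely by `2B` off the good event. -/

theorem combo_le (hφ : IsDivergence φ) {a b x y : ℝ} (ha : 0 ≤ a) (hb : 0 ≤ b)
    (hab : a + b = 1) :
    φ (a * x + b * y) ≤ ENNReal.ofReal a * φ x + ENNReal.ofReal b * φ y := by
  have h := hφ.convex.2 (Set.mem_univ x) (Set.mem_univ y)
    (zero_le : 0 ≤ a.toNNReal) (zero_le : 0 ≤ b.toNNReal) (by rw [← Real.toNNReal_add ha hb, hab, Real.toNNReal_one])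
  simpa [NNReal.smul_def, ENNReal.smul_def, ENNReal.ofReal, Real.coe_toNNReal _ ha, Real.coe_toNNReal _ hb] using h

theorem toward_one_le (hφ : IsDivergence φ) {t x : ℝ} (h0 : 0 ≤ t) (h1 : t ≤ 1) :
    φ (x + t * (1 - x)) ≤ φ x := by
  have h := hφ.combo_le (a := 1 - t) (b := t) (x := x) (y := 1) (by linarith) h0 (by ring)
  rw [hφ.one, mul_zero, add_zero] at h
  calc φ (x + t * (1 - x)) = φ ((1 - t) * x + t * 1) := by congr 1; ring
    _ ≤ _ := h
    _ ≤ 1 * φ x := by gcongr; exact ENNReal.ofReal_le_one.2 (by linarith)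
    _ = φ x := one_mul _

/-- A nonnegative convex function vanishing at `1` decreases towards `1`. Every modification of a
density below moves values towards `1`, so the divergence budget is never exceeded. -/
theorem le_of_mem_uIcc (hφ : IsDivergence φ) {x y : ℝ} (h : y ∈ Set.uIcc x 1) : φ y ≤ φ x := by
  rw [← segment_eq_uIcc] at h
  obtain ⟨a, b, ha, hb, hab, rfl⟩ := h
  have := hφ.toward_one_le (x := x) hb (by linarith)
  convert this using 2
  simp only [smul_eq_mul]
  obtain rfl : a = 1 - b := by linarith
  ring

theorem measurable (hφ : IsDivergence φ) : Measurable φ := hφ.lsc.measurable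

theorem nonneg_of_ne_top (hφ : IsDivergence φ) {x : ℝ} (h : φ x ≠ ⊤) : 0 ≤ x := by
  by_contra hx
  exact h (hφ.neg x (not_le.1 hx))

end IsDivergence

theorem le_truncDivergence (φ : ℝ → ℝ≥0∞) (L x : ℝ) : φ x ≤ truncDivergence φ L x := by
  unfold truncDivergence
  split_ifs <;> simp

theorem truncDivergence_of_mem (φ : ℝ → ℝ≥0∞) {L x : ℝ} (h : x ∈ Set.Icc 0 L) :
    truncDivergence φ L x = φ x := if_pos h

theorem truncDivergence_of_notMem (φ : ℝ → ℝ≥0∞) {L x : ℝ} (h : x ∉ Set.Icc 0 L) :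
    truncDivergence φ L x = ⊤ := if_neg h

theorem mem_Icc_of_truncDivergence_ne_top {φ : ℝ → ℝ≥0∞} {L x : ℝ}
    (h : truncDivergence φ L x ≠ ⊤) : x ∈ Set.Icc 0 L := by
  by_contra hx
  exact h (truncDivergence_of_notMem φ hx)

theorem IsDivergence.trunc {φ : ℝ → ℝ≥0∞} (hφ : IsDivergence φ) {L : ℝ} (hL : 1 ≤ L) :
    IsDivergence (truncDivergence φ L) where
  convex := by
    refine ⟨convex_univ, fun x _ y _ a b _ _ hab => ?_⟩
    -- Zero weights are treated apart: `0 * ⊤ = 0`, so an infinite endpoint makes the right side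
    -- infinite only when its weight is positive.
    rcases eq_or_ne a 0 with rfl | ha0
    · obtain rfl : b = 1 := by simpa using hab
      simp
    rcases eq_or_ne b 0 with rfl | hb0
    · obtain rfl : a = 1 := by simpa using hab
      simp
    by_cases hx : x ∈ Set.Icc 0 L
    · by_cases hy : y ∈ Set.Icc 0 L
      · have hab' : (a : ℝ) + b = 1 := by exact_mod_cast hab
        have hm : a • x + b • y ∈ Set.Icc 0 L :=
          (convex_Icc (0 : ℝ) L) hx hy a.2 b.2 hab
        rw [truncDivergence_of_mem φ hx, truncDivergence_of_mem φ hy,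
          truncDivergence_of_mem φ hm]
        exact hφ.convex.2 (Set.mem_univ x) (Set.mem_univ y) zero_le zero_le hab
      · rw [truncDivergence_of_notMem φ hy]
        simp [ENNReal.smul_def, hb0]
    · rw [truncDivergence_of_notMem φ hx]
      simp [ENNReal.smul_def, ha0]
  lsc := by
    intro x c hc
    by_cases hx : x ∈ Set.Icc 0 L
    · rw [truncDivergence_of_mem φ hx] at hc
      exact (hφ.lsc x c hc).mono fun y hy => hy.trans_le (le_truncDivergence φ L y)
    · filter_upwards [isClosed_Icc.isOpen_compl.mem_nhds hx] with y hy
      rw [truncDivergence_of_notMem φ hy]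
      rwa [truncDivergence_of_notMem φ hx] at hc
  one := by rw [truncDivergence_of_mem φ ⟨zero_le_one, hL⟩, hφ.one]
  neg x hx := truncDivergence_of_notMem φ fun h => absurd h.1 (not_le.2 hx)

/-! ### Densities, the ambiguity set and exact penalisation of the mass -/

section Density

variable {Ω : Type*} [MeasurableSpace Ω] {P : Measure Ω} {ζ : Ω → ℝ}

theorem IsDensity.integrable (h : IsDensity P ζ) : Integrable ζ P := by
  refine ⟨h.measurable.aestronglyMeasurable, ?_⟩
  rw [hasFiniteIntegral_iff_ofReal (ae_of_all _ h.nonneg), h.lintegral_eq_one]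
  exact ENNReal.one_lt_top

theorem IsDensity.integral_eq_one (h : IsDensity P ζ) : ∫ ω, ζ ω ∂P = 1 := by
  rw [integral_eq_lintegral_of_nonneg_ae (ae_of_all _ h.nonneg)
    h.measurable.aestronglyMeasurable, h.lintegral_eq_one, ENNReal.toReal_one]

theorem isDensity_of_integral_eq_one (hm : Measurable ζ) (h0 : ∀ ω, 0 ≤ ζ ω)
    (hi : Integrable ζ P) (h1 : ∫ ω, ζ ω ∂P = 1) : IsDensity P ζ :=
  ⟨hm, h0, by rw [← ofReal_integral_eq_lintegral_ofReal hi (ae_of_all _ h0), h1,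
    ENNReal.ofReal_one]⟩

variable {B : ℝ} {X : Ω → ℝ}

theorem integrable_mul_of_bounded (hX : Measurable X) (hXB : ∀ ω, |X ω| ≤ B)
    (hζ : Integrable ζ P) : Integrable (fun ω => X ω * ζ ω) P :=
  hζ.bdd_mul hX.aestronglyMeasurable (ae_of_all _ hXB)

theorem abs_integral_mul_le (hX : Measurable X) (hXB : ∀ ω, |X ω| ≤ B)
    (hζ : Integrable ζ P) : |∫ ω, X ω * ζ ω ∂P| ≤ B * ∫ ω, |ζ ω| ∂P := by
  calc |∫ ω, X ω * ζ ω ∂P| ≤ ∫ ω, |X ω * ζ ω| ∂P := abs_integral_le_integral_abs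
    _ ≤ ∫ ω, B * |ζ ω| ∂P := by
        refine integral_mono (integrable_mul_of_bounded hX hXB hζ).abs (hζ.abs.const_mul B) ?_
        intro ω
        simp only [abs_mul]
        exact mul_le_mul_of_nonneg_right (hXB ω) (abs_nonneg _)
    _ = _ := integral_const_mul _ _

theorem IsDensity.abs_integral_mul_le (h : IsDensity P ζ) (hX : Measurable X)
    (hXB : ∀ ω, |X ω| ≤ B) : |∫ ω, X ω * ζ ω ∂P| ≤ B := by
  have := _root_.abs_integral_mul_le hX hXB h.integrable
  simpa [abs_of_nonneg (h.nonneg _), h.integral_eq_one] using this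

theorem one_mem_ambiguitySet [IsProbabilityMeasure P] {φ : ℝ → ℝ≥0∞} (hφ : IsDivergence φ)
    (τ : ℝ) : (fun _ => 1) ∈ ambiguitySet φ τ P :=
  ⟨⟨measurable_const, fun _ => zero_le_one, by simp⟩, by simp [hφ.one]⟩

variable {φ : ℝ → ℝ≥0∞} {τ : ℝ}

theorem integral_le_robustRisk (hX : Measurable X) (hXB : ∀ ω, |X ω| ≤ B)
    (hζ : ζ ∈ ambiguitySet φ τ P) : ∫ ω, X ω * ζ ω ∂P ≤ robustRisk φ τ P X := by
  refine le_csSup ⟨B, ?_⟩ (Set.mem_image_of_mem _ hζ)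
  rintro _ ⟨ξ, hξ, rfl⟩
  exact (abs_le.1 (hξ.1.abs_integral_mul_le hX hXB)).2

theorem robustRisk_le [IsProbabilityMeasure P] (hφ : IsDivergence φ) {c : ℝ}
    (h : ∀ ζ ∈ ambiguitySet φ τ P, ∫ ω, X ω * ζ ω ∂P ≤ c) : robustRisk φ τ P X ≤ c := by
  refine csSup_le ⟨_, Set.mem_image_of_mem _ (one_mem_ambiguitySet hφ τ)⟩ ?_
  rintro _ ⟨ξ, hξ, rfl⟩
  exact h ξ hξ

theorem integral_le_robustRisk_self [IsProbabilityMeasure P] (hφ : IsDivergence φ)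
    (hX : Measurable X) (hXB : ∀ ω, |X ω| ≤ B) : ∫ ω, X ω ∂P ≤ robustRisk φ τ P X := by
  simpa using integral_le_robustRisk hX hXB (one_mem_ambiguitySet (P := P) hφ τ)

theorem abs_robustRisk_le [IsProbabilityMeasure P] (hφ : IsDivergence φ)
    (hX : Measurable X) (hXB : ∀ ω, |X ω| ≤ B) : |robustRisk φ τ P X| ≤ B := by
  refine abs_le.2 ⟨?_, robustRisk_le hφ fun ξ hξ =>
    (abs_le.1 (hξ.1.abs_integral_mul_le hX hXB)).2⟩
  have h1 := one_mem_ambiguitySet (P := P) hφ τ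
  exact (abs_le.1 (h1.1.abs_integral_mul_le hX hXB)).1.trans (integral_le_robustRisk hX hXB h1)

theorem robustRisk_mono [IsProbabilityMeasure P] {ψ : ℝ → ℝ≥0∞} (hψ : IsDivergence ψ)
    (hle : ∀ x, φ x ≤ ψ x) (hX : Measurable X) (hXB : ∀ ω, |X ω| ≤ B) :
    robustRisk ψ τ P X ≤ robustRisk φ τ P X :=
  robustRisk_le hψ fun _ hξ => integral_le_robustRisk hX hXB
    ⟨hξ.1, (lintegral_mono fun _ => hle _).trans hξ.2⟩

/-- A nonnegative integrable function can be moved pointwise towards `1` so as to become a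
density, at an `L¹`-cost equal to the defect of its mass. -/
theorem exists_isDensity_toward_one [IsProbabilityMeasure P] (hm : Measurable ζ)
    (h0 : ∀ ω, 0 ≤ ζ ω) (hi : Integrable ζ P) :
    ∃ ξ : Ω → ℝ, IsDensity P ξ ∧ (∀ ω, ξ ω ∈ Set.uIcc (ζ ω) 1) ∧
      ∫ ω, |ζ ω - ξ ω| ∂P = |∫ ω, ζ ω ∂P - 1| := by
  -- `s` is the sign of the missing mass. Only points lying on the corresponding side of `1` are
  -- moved, all by the same fraction `t` of their distance to `1`; all moves have the same sign, so
  -- the `L¹`-cost is exactly the mass defect.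
  obtain ⟨s, hs, hd⟩ : ∃ s : ℝ, |s| = 1 ∧ |∫ ω, ζ ω ∂P - 1| = s * (1 - ∫ ω, ζ ω ∂P) := by
    rcases le_total (∫ ω, ζ ω ∂P) 1 with h | h
    · exact ⟨1, by simp, by rw [abs_of_nonpos (by linarith)]; ring⟩
    · exact ⟨-1, by simp, by rw [abs_of_nonneg (by linarith)]; ring⟩
  have hss : s * s = 1 := by rw [← abs_mul_abs_self, hs, one_mul]
  set d := |∫ ω, ζ ω ∂P - 1| with hd_def
  set g : Ω → ℝ := fun ω => max (s * (1 - ζ ω)) 0 with hg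
  have hgi : Integrable g P := (((integrable_const 1).sub hi).const_mul s).pos_part
  have hg0 : ∀ ω, 0 ≤ g ω := fun ω => le_max_right _ _
  have hdg : d ≤ ∫ ω, g ω ∂P := by
    rw [hd]
    calc s * (1 - ∫ ω, ζ ω ∂P) = ∫ ω, s * (1 - ζ ω) ∂P := by
          rw [integral_const_mul, integral_sub (integrable_const 1) hi]; simp
      _ ≤ _ := integral_mono (((integrable_const 1).sub hi).const_mul s) hgi
          fun ω => le_max_left _ _
  obtain ⟨t, ht0, ht1, ht⟩ : ∃ t : ℝ, 0 ≤ t ∧ t ≤ 1 ∧ t * ∫ ω, g ω ∂P = d := by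
    have hd0 : 0 ≤ d := abs_nonneg _
    rcases hd0.eq_or_lt with h | h
    · exact ⟨0, le_rfl, zero_le_one, by rw [zero_mul, h]⟩
    · have hp := h.trans_le hdg
      exact ⟨d / ∫ ω, g ω ∂P, by positivity, (div_le_one hp).2 hdg,
        div_mul_cancel₀ _ hp.ne'⟩
  have hgm : Measurable g := by fun_prop
  have hmem : ∀ ω, ζ ω + s * (t * g ω) ∈ Set.uIcc (ζ ω) 1 := by
    intro ω
    rw [← segment_eq_uIcc]
    rcases le_total (s * (1 - ζ ω)) 0 with h | h
    · exact ⟨1, 0, zero_le_one, le_rfl, by ring, by simp [hg, max_eq_right h]⟩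
    · refine ⟨1 - t, t, by linarith, ht0, by ring, ?_⟩
      simp only [hg, max_eq_left h, smul_eq_mul]
      linear_combination (-t * (1 - ζ ω)) * hss
  have hξi : Integrable (fun ω => ζ ω + s * (t * g ω)) P :=
    hi.add ((hgi.const_mul t).const_mul s)
  refine ⟨fun ω => ζ ω + s * (t * g ω), isDensity_of_integral_eq_one (by fun_prop) ?_ hξi ?_,
    hmem, ?_⟩
  · intro ω
    have := (hmem ω).1
    exact (le_min (h0 ω) zero_le_one).trans this
  · rw [integral_add hi ((hgi.const_mul t).const_mul s), integral_const_mul, integral_const_mul,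
      ht, hd]
    linear_combination (1 - ∫ ω, ζ ω ∂P) * hss
  · have : ∀ ω, |ζ ω - (ζ ω + s * (t * g ω))| = t * g ω := fun ω => by
      rw [sub_add_cancel_left, abs_neg, abs_mul, hs, one_mul,
        abs_of_nonneg (mul_nonneg ht0 (hg0 ω))]
    simp_rw [this]
    rw [integral_const_mul, ht]

/-- The mass constraint may be replaced by an exact penalty. -/
theorem integral_le_robustRisk_add_penalty [IsProbabilityMeasure P] (hφ : IsDivergence φ)
    (hX : Measurable X) (hXB : ∀ ω, |X ω| ≤ B) (hm : Measurable ζ) (h0 : ∀ ω, 0 ≤ ζ ω)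
    (hi : Integrable ζ P) (hτ : ∫⁻ ω, φ (ζ ω) ∂P ≤ ENNReal.ofReal τ) :
    ∫ ω, X ω * ζ ω ∂P ≤ robustRisk φ τ P X + B * |∫ ω, ζ ω ∂P - 1| := by
  obtain ⟨ξ, hξ, hmem, hd⟩ := exists_isDensity_toward_one hm h0 hi
  have h1 := integral_le_robustRisk hX hXB (φ := φ) (τ := τ)
    ⟨hξ, (lintegral_mono fun ω => hφ.le_of_mem_uIcc (hmem ω)).trans hτ⟩
  have h2 := abs_integral_mul_le hX hXB (hi.sub hξ.integrable)
  simp only [Pi.sub_apply, mul_sub] at h2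
  rw [integral_sub (integrable_mul_of_bounded hX hXB hi)
    (integrable_mul_of_bounded hX hXB hξ.integrable), hd] at h2
  linarith [(abs_le.1 h2).2]

end Density

/-! ### Lagrange multipliers by separation -/

section Duality

variable {Ω : Type*} [MeasurableSpace Ω] {P : Measure Ω} {B τ : ℝ} {X : Ω → ℝ}
  {φ : ℝ → ℝ≥0∞}

/-- The attainable triples `(∫ ζ, b, c)` with `∫ φ(ζ) ≤ b` and `c ≤ ∫ X ζ`. -/
def attainable (φ : ℝ → ℝ≥0∞) (P : Measure Ω) (X : Ω → ℝ) : Set (ℝ × ℝ × ℝ) :=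
  {p | 0 ≤ p.2.1 ∧ ∃ ζ : Ω → ℝ, Measurable ζ ∧ (∀ ω, 0 ≤ ζ ω) ∧ Integrable ζ P ∧
    ∫ ω, ζ ω ∂P = p.1 ∧ ∫⁻ ω, φ (ζ ω) ∂P ≤ ENNReal.ofReal p.2.1 ∧ p.2.2 ≤ ∫ ω, X ω * ζ ω ∂P}

theorem convex_attainable (hφ : IsDivergence φ) (hX : Measurable X) (hXB : ∀ ω, |X ω| ≤ B) :
    Convex ℝ (attainable φ P X) := by
  rintro ⟨a₁, b₁, c₁⟩ ⟨hb₁, ζ₁, hm₁, h₁, hi₁, rfl, hφ₁, hc₁⟩ ⟨a₂, b₂, c₂⟩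
    ⟨hb₂, ζ₂, hm₂, h₂, hi₂, rfl, hφ₂, hc₂⟩ s t hs ht hst
  simp only at hb₁ hφ₁ hc₁ hb₂ hφ₂ hc₂
  refine ⟨by simp only [Prod.snd_add, Prod.smul_snd, Prod.fst_add, Prod.smul_fst, smul_eq_mul]
             positivity,
    fun ω => s * ζ₁ ω + t * ζ₂ ω, by fun_prop, fun ω => ?_,
    (hi₁.const_mul s).add (hi₂.const_mul t), ?_, ?_, ?_⟩
  · have := h₁ ω; have := h₂ ω; positivity
  · rw [integral_add (hi₁.const_mul s) (hi₂.const_mul t), integral_const_mul,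
      integral_const_mul]
    simp
  · calc ∫⁻ ω, φ (s * ζ₁ ω + t * ζ₂ ω) ∂P
        ≤ ∫⁻ ω, (ENNReal.ofReal s * φ (ζ₁ ω) + ENNReal.ofReal t * φ (ζ₂ ω)) ∂P :=
          lintegral_mono fun ω => hφ.combo_le hs ht hst
      _ = ENNReal.ofReal s * ∫⁻ ω, φ (ζ₁ ω) ∂P + ENNReal.ofReal t * ∫⁻ ω, φ (ζ₂ ω) ∂P := by
          have m₁ : Measurable fun ω => φ (ζ₁ ω) := hφ.measurable.comp hm₁
          have m₂ : Measurable fun ω => φ (ζ₂ ω) := hφ.measurable.comp hm₂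
          rw [lintegral_add_left (m₁.const_mul _), lintegral_const_mul _ m₁,
            lintegral_const_mul _ m₂]
      _ ≤ ENNReal.ofReal s * ENNReal.ofReal b₁ + ENNReal.ofReal t * ENNReal.ofReal b₂ := by
          gcongr
      _ = ENNReal.ofReal (s * b₁ + t * b₂) := by
          rw [ENNReal.ofReal_add (by positivity) (by positivity), ENNReal.ofReal_mul hs,
            ENNReal.ofReal_mul ht]
  · have e : ∫ ω, X ω * (s * ζ₁ ω + t * ζ₂ ω) ∂P
        = s * ∫ ω, X ω * ζ₁ ω ∂P + t * ∫ ω, X ω * ζ₂ ω ∂P := by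
      rw [← integral_const_mul, ← integral_const_mul, ← integral_add
        ((integrable_mul_of_bounded hX hXB hi₁).const_mul s)
        ((integrable_mul_of_bounded hX hXB hi₂).const_mul t)]
      congr 1; ext ω; ring
    rw [e]
    simp only [Prod.snd_add, Prod.smul_snd, smul_eq_mul]
    gcongr

/-- Existence of Lagrange multipliers for the divergence and the mass constraint. -/
theorem exists_multipliers [IsProbabilityMeasure P] (hφ : IsDivergence φ) (hτ : 0 < τ)
    (hX : Measurable X) (hB : 0 ≤ B) (hXB : ∀ ω, |X ω| ≤ B) :
    ∃ l μ : ℝ, 0 ≤ l ∧ |μ| ≤ B ∧ ∀ (ζ : Ω → ℝ) (b : ℝ), Measurable ζ → (∀ ω, 0 ≤ ζ ω) →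
      Integrable ζ P → 0 ≤ b → ∫⁻ ω, φ (ζ ω) ∂P ≤ ENNReal.ofReal b →
      ∫ ω, X ω * ζ ω ∂P - l * b - μ * ∫ ω, ζ ω ∂P ≤ robustRisk φ τ P X - l * τ - μ := by
  set R := robustRisk φ τ P X with hR
  -- Triples that beat the exact penalty bound under a budget below `τ`; none is attainable. The
  -- slope `B` of the penalty is what later bounds `μ`.
  set U : Set (ℝ × ℝ × ℝ) := {p | p.2.1 < τ ∧ R + B * |p.1 - 1| < p.2.2} with hU
  have hUo : IsOpen U := by
    have h1 : IsOpen {p : ℝ × ℝ × ℝ | p.2.1 < τ} := isOpen_lt (by fun_prop) (by fun_prop)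
    have h2 : IsOpen {p : ℝ × ℝ × ℝ | R + B * |p.1 - 1| < p.2.2} :=
      isOpen_lt (by fun_prop) (by fun_prop)
    exact h1.inter h2
  have hUc : Convex ℝ U := by
    rintro ⟨a₁, b₁, c₁⟩ ⟨hb₁, hc₁⟩ ⟨a₂, b₂, c₂⟩ ⟨hb₂, hc₂⟩ s t hs ht hst
    simp only at hb₁ hc₁ hb₂ hc₂
    have habs : |s * a₁ + t * a₂ - 1| ≤ s * |a₁ - 1| + t * |a₂ - 1| := by
      calc |s * a₁ + t * a₂ - 1| = |s * (a₁ - 1) + t * (a₂ - 1)| := by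
            congr 1; linear_combination hst
        _ ≤ |s * (a₁ - 1)| + |t * (a₂ - 1)| := abs_add_le _ _
        _ = _ := by rw [abs_mul, abs_mul, abs_of_nonneg hs, abs_of_nonneg ht]
    have hpos : 0 < s ∨ 0 < t := by
      rcases hs.eq_or_lt with h | h
      · right; linarith
      · exact Or.inl h
    refine ⟨?_, ?_⟩
    · change s * b₁ + t * b₂ < τ
      rcases hpos with h | h
      · nlinarith [mul_lt_mul_of_pos_left hb₁ h, mul_le_mul_of_nonneg_left hb₂.le ht]
      · nlinarith [mul_lt_mul_of_pos_left hb₂ h, mul_le_mul_of_nonneg_left hb₁.le hs]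
    · change R + B * |s * a₁ + t * a₂ - 1| < s * c₁ + t * c₂
      have h1 := mul_le_mul_of_nonneg_left habs hB
      have h2 : s * (R + B * |a₁ - 1|) + t * (R + B * |a₂ - 1|) < s * c₁ + t * c₂ := by
        rcases hpos with h | h
        · linarith [mul_lt_mul_of_pos_left hc₁ h, mul_le_mul_of_nonneg_left hc₂.le ht]
        · linarith [mul_lt_mul_of_pos_left hc₂ h, mul_le_mul_of_nonneg_left hc₁.le hs]
      have h3 : s * (R + B * |a₁ - 1|) + t * (R + B * |a₂ - 1|)
          = R + B * (s * |a₁ - 1| + t * |a₂ - 1|) := by linear_combination R * hst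
      linarith
  have hdisj : Disjoint U (attainable φ P X) := by
    rw [Set.disjoint_left]
    rintro ⟨a, b, c⟩ ⟨hb, hc⟩ ⟨_, ζ, hm, h0, hi, rfl, hφζ, hcX⟩
    simp only at hb hc hφζ hcX
    have := integral_le_robustRisk_add_penalty hφ hX hXB hm h0 hi
      (hφζ.trans (ENNReal.ofReal_le_ofReal hb.le))
    linarith
  obtain ⟨f, u, hfU, hfA⟩ :=
    geometric_hahn_banach_open hUc hUo (convex_attainable hφ hX hXB) hdisj
  set α := f (1, 0, 0) with hα
  set β := f (0, 1, 0) with hβ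
  set γ := f (0, 0, 1) with hγ
  have hf : ∀ a b c : ℝ, f (a, b, c) = a * α + b * β + c * γ := by
    intro a b c
    have : ((a, b, c) : ℝ × ℝ × ℝ) = a • (1, 0, 0) + b • (0, 1, 0) + c • (0, 0, 1) := by simp
    rw [this, map_add, map_add, map_smul, map_smul, map_smul]
    simp [hα, hβ, hγ]
  -- The separating inequality passes to the non-strict version of `U` by pushing `b` down and `c`
  -- up slightly.
  have hU' : ∀ a b c : ℝ, b ≤ τ → R + B * |a - 1| ≤ c → a * α + b * β + c * γ ≤ u := by
    intro a b c hb hc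
    refine le_of_forall_pos_lt_add fun e he => ?_
    set k := |β| + |γ| + 1 with hk
    have hk0 : 0 < k := by positivity
    have hd : 0 < e / k := by positivity
    have := hfU (a, b - e / k, c + e / k) ⟨by change b - e / k < τ; linarith,
      by change _ < c + e / k; linarith⟩
    rw [hf] at this
    have hek : e / k * k = e := div_mul_cancel₀ _ hk0.ne'
    nlinarith [neg_abs_le β, le_abs_self β, neg_abs_le γ, le_abs_self γ]
  have hA1 : ∀ c, c ≤ ∫ ω, X ω ∂P → u ≤ α + c * γ := by
    intro c hc
    have := hfA (1, 0, c) ⟨le_rfl, fun _ => 1, measurable_const, fun _ => zero_le_one,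
      integrable_const 1, by simp, by simp [hφ.one], by simpa using hc⟩
    simpa [hf] using this
  set E := ∫ ω, X ω ∂P with hE
  have hER : E ≤ R := integral_le_robustRisk_self hφ hX hXB
  -- `U` is unbounded upwards in the reward and downwards in the budget; this fixes the signs of `γ`
  -- and `β`.
  have hγ0 : γ ≤ 0 := by
    by_contra! h
    have h1 := hU' 1 τ (R + |u - α - τ * β - R * γ| / γ + 1 / γ) le_rfl (by
      simp only [sub_self, abs_zero, mul_zero, add_zero]
      have : 0 ≤ |u - α - τ * β - R * γ| / γ := by positivity
      have : 0 ≤ 1 / γ := by positivity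
      linarith)
    have e1 : |u - α - τ * β - R * γ| / γ * γ = |u - α - τ * β - R * γ| :=
      div_mul_cancel₀ _ h.ne'
    have e2 : 1 / γ * γ = 1 := div_mul_cancel₀ _ h.ne'
    nlinarith [le_abs_self (u - α - τ * β - R * γ)]
  have hβ0 : 0 ≤ β := by
    by_contra! h
    have h1 := hU' 1 (min τ ((u - α - R * γ + 1) / β)) R (min_le_left _ _) (by simp)
    have h2 := mul_le_mul_of_nonpos_right (min_le_right τ ((u - α - R * γ + 1) / β)) h.le
    rw [div_mul_cancel₀ _ h.ne] at h2
    linarith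
  -- Slater's condition: `ζ = 1` has zero divergence, strictly within the budget `τ > 0`, so the
  -- separating functional is not degenerate in the reward.
  have hγneg : γ < 0 := by
    refine hγ0.lt_of_ne fun h0 => ?_
    have h1 := hA1 E le_rfl
    have h3 := hfU (1, τ / 2, R + 1) ⟨by change τ / 2 < τ; linarith, by simp⟩
    rw [hf, h0] at h3
    rw [h0] at h1
    linarith [mul_nonneg hτ.le hβ0]
  have hdiv : ∀ a b c : ℝ, b ≤ τ → R + B * |a - 1| ≤ c →
      ∀ ζ : Ω → ℝ, ∀ b', Measurable ζ → (∀ ω, 0 ≤ ζ ω) →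
      Integrable ζ P → 0 ≤ b' → ∫⁻ ω, φ (ζ ω) ∂P ≤ ENNReal.ofReal b' →
      a * α + b * β + c * γ ≤ (∫ ω, ζ ω ∂P) * α + b' * β + (∫ ω, X ω * ζ ω ∂P) * γ := by
    intro a b c hb hc ζ b' hm h0 hi hb' hζ
    have := hfA (∫ ω, ζ ω ∂P, b', ∫ ω, X ω * ζ ω ∂P) ⟨hb', ζ, hm, h0, hi, rfl, hζ, le_rfl⟩
    rw [hf] at this
    exact (hU' a b c hb hc).trans this
  have hg : 0 < -γ := by linarith
  have hg' : -γ ≠ 0 := hg.ne'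
  refine ⟨β / (-γ), α / (-γ), by positivity, ?_, ?_⟩
  · rw [abs_div, abs_of_pos hg, div_le_iff₀ hg]
    by_contra! h
    obtain ⟨s, hs, hsα⟩ : ∃ s : ℝ, |s| = 1 ∧ s * α = |α| := by
      rcases le_total 0 α with h | h
      · exact ⟨1, by simp, by rw [abs_of_nonneg h, one_mul]⟩
      · exact ⟨-1, by simp, by rw [abs_of_nonpos h]; ring⟩
    set D := |α| - B * -γ with hD
    have hD0 : 0 < D := by linarith
    set T := (|u - α - τ * β - R * γ| + 1) / D with hT
    have hT0 : 0 ≤ T := by positivity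
    have hTD : T * D = |u - α - τ * β - R * γ| + 1 := div_mul_cancel₀ _ hD0.ne'
    -- Going far along the edge of the penalty cone contradicts the separation unless `|α| ≤ B *
    -- -γ`.
    have h1 := hU' (1 + s * T) τ (R + B * T) le_rfl (by
      rw [add_sub_cancel_left, abs_mul, hs, abs_of_nonneg hT0, one_mul])
    have h2 : (1 + s * T) * α + τ * β + (R + B * T) * γ
        = α + τ * β + R * γ + T * D := by rw [hD]; linear_combination T * hsα
    linarith [le_abs_self (u - α - τ * β - R * γ)]
  · intro ζ b hm h0 hi hb hζ
    have h1 := hdiv 1 τ R le_rfl (by simp) ζ b hm h0 hi hb hζ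
    clear_value γ
    obtain ⟨g, rfl⟩ : ∃ g, γ = -g := ⟨-γ, by ring⟩
    rw [neg_neg] at hg hg' ⊢
    have e1 : ∫ ω, X ω * ζ ω ∂P - β / g * b - α / g * ∫ ω, ζ ω ∂P
        = ((∫ ω, X ω * ζ ω ∂P) * g - β * b - α * ∫ ω, ζ ω ∂P) / g := by
      field_simp
    have e2 : R - β / g * τ - α / g = (R * g - β * τ - α) / g := by
      field_simp
    rw [e1, e2]
    gcongr ?_ / _
    linarith

end Duality

/-! ### The conjugate integrand and strong duality -/

section Conjugate

variable {φ : ℝ → ℝ≥0∞}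

/-- A rational point of the domain of `φ`, with default value `1`. -/
noncomputable def domPoint (φ : ℝ → ℝ≥0∞) (q : ℚ) : ℝ :=
  open Classical in if φ q = ⊤ then 1 else q

/-- The excess `(lφ)*(y) - y` of the convex conjugate over its value at `1`. -/
noncomputable def conjExcess (φ : ℝ → ℝ≥0∞) (l y : ℝ) : ℝ≥0∞ :=
  ⨆ q : ℚ, ENNReal.ofReal ((domPoint φ q - 1) * y - l * (φ (domPoint φ q)).toReal)

theorem IsDivergence.domPoint_ne_top (hφ : IsDivergence φ) (q : ℚ) : φ (domPoint φ q) ≠ ⊤ := by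
  unfold domPoint
  split_ifs with h
  · simp [hφ.one]
  · exact h

theorem domPoint_of_ne_top {q : ℚ} (h : φ q ≠ ⊤) : domPoint φ q = q := if_neg h

@[fun_prop]
theorem measurable_conjExcess (φ : ℝ → ℝ≥0∞) (l : ℝ) : Measurable (conjExcess φ l) :=
  Measurable.iSup fun q => by fun_prop

theorem conjExcess_antitone {l l' : ℝ} (h : l ≤ l') (y : ℝ) :
    conjExcess φ l' y ≤ conjExcess φ l y := by
  refine iSup_mono fun q => ENNReal.ofReal_le_ofReal ?_
  gcongr

/-- Rational points suffice: step from `z` towards `1` to a rational within `e / (|y| + 1)`. There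
`φ` is no larger and the linear term changes by at most `e`. The point `1` is itself rational, which
covers a domain reduced to `{1}`. -/
theorem IsDivergence.le_conjExcess (hφ : IsDivergence φ) {l z : ℝ} (hl : 0 ≤ l) (hz : φ z ≠ ⊤)
    (y : ℝ) :
    ENNReal.ofReal ((z - 1) * y - l * (φ z).toReal) ≤ conjExcess φ l y := by
  refine ENNReal.le_of_forall_pos_le_add fun e he _ => ?_
  have hle : ∀ w ∈ Set.uIcc z 1, φ w ≤ φ z := fun w hw => hφ.le_of_mem_uIcc hw
  set r : ℝ := e / (|y| + 1) with hr
  have hy : 0 < |y| + 1 := by positivity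
  have hr0 : 0 < r := div_pos (by exact_mod_cast he) hy
  have key : ∀ q : ℚ, (q : ℝ) ∈ Set.uIcc z 1 → |z - q| ≤ r →
      ENNReal.ofReal ((z - 1) * y - l * (φ z).toReal) ≤ conjExcess φ l y + e := by
    intro q hq hd
    have hqt : φ q ≠ ⊤ := ((hle q hq).trans_lt hz.lt_top).ne
    have h1 : (z - 1) * y - l * (φ z).toReal
        ≤ ((domPoint φ q - 1) * y - l * (φ (domPoint φ q)).toReal) + e := by
      rw [domPoint_of_ne_top hqt]
      have h2 : l * (φ q).toReal ≤ l * (φ z).toReal :=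
        mul_le_mul_of_nonneg_left (ENNReal.toReal_mono hz (hle q hq)) hl
      have h3 : (z - q) * y ≤ e := by
        calc (z - q) * y ≤ |z - q| * |y| := by rw [← abs_mul]; exact le_abs_self _
          _ ≤ r * (|y| + 1) := by gcongr; linarith
          _ = e := div_mul_cancel₀ _ hy.ne'
      linarith
    calc ENNReal.ofReal ((z - 1) * y - l * (φ z).toReal)
        ≤ ENNReal.ofReal ((domPoint φ q - 1) * y - l * (φ (domPoint φ q)).toReal)
            + ENNReal.ofReal e := (ENNReal.ofReal_le_ofReal h1).trans ENNReal.ofReal_add_le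
      _ ≤ _ := by
          rw [ENNReal.ofReal_coe_nnreal]
          gcongr
          exact le_iSup (fun q : ℚ =>
            ENNReal.ofReal ((domPoint φ q - 1) * y - l * (φ (domPoint φ q)).toReal)) q
  rcases lt_trichotomy z 1 with h | h | h
  · obtain ⟨q, hq1, hq2⟩ := exists_rat_btwn (lt_min h (lt_add_of_pos_right z hr0))
    rw [lt_min_iff] at hq2
    refine key q ?_ ?_
    · rw [Set.uIcc_of_le h.le]; exact ⟨hq1.le, hq2.1.le⟩
    · rw [abs_le]; constructor <;> linarith
  · refine key 1 ?_ ?_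
    · simp [h]
    · simp [h, hr0.le]
  · obtain ⟨q, hq1, hq2⟩ := exists_rat_btwn (max_lt h (sub_lt_self z hr0))
    rw [max_lt_iff] at hq1
    refine key q ?_ ?_
    · rw [Set.uIcc_of_ge h.le]; exact ⟨hq1.1.le, hq2.le⟩
    · rw [abs_le]; constructor <;> linarith

theorem IsDivergence.le_toReal_conjExcess (hφ : IsDivergence φ) {l z y : ℝ} (hl : 0 ≤ l)
    (hz : φ z ≠ ⊤) (hy : conjExcess φ l y ≠ ⊤) :
    (z - 1) * y - l * (φ z).toReal ≤ (conjExcess φ l y).toReal :=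
  (ENNReal.ofReal_le_iff_le_toReal hy).1 (hφ.le_conjExcess hl hz y)

variable {L : ℝ}

theorem abs_domPoint_trunc_sub_one_le (hφ : IsDivergence φ) (hL : 1 ≤ L) (q : ℚ) :
    |domPoint (truncDivergence φ L) q - 1| ≤ L := by
  have := mem_Icc_of_truncDivergence_ne_top ((hφ.trunc hL).domPoint_ne_top q)
  rw [abs_le]
  constructor <;> linarith [this.1, this.2]

/-- A supremum of affine functions of `y` with slopes `c - 1`, where `c ∈ [0, L]`, is `L`-Lipschitz.
-/
theorem conjExcess_trunc_le_add (hφ : IsDivergence φ) (hL : 1 ≤ L) (l y y' : ℝ) :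
    conjExcess (truncDivergence φ L) l y
      ≤ conjExcess (truncDivergence φ L) l y' + ENNReal.ofReal (L * |y - y'|) := by
  refine iSup_le fun q => ?_
  set c := domPoint (truncDivergence φ L) q with hc
  have h1 : (c - 1) * (y - y') ≤ L * |y - y'| := by
    calc (c - 1) * (y - y') ≤ |c - 1| * |y - y'| := by rw [← abs_mul]; exact le_abs_self _
      _ ≤ _ := by gcongr; exact abs_domPoint_trunc_sub_one_le hφ hL q
  have h2 : (c - 1) * y - l * (truncDivergence φ L c).toReal
      ≤ ((c - 1) * y' - l * (truncDivergence φ L c).toReal) + L * |y - y'| := by linarith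
  refine ((ENNReal.ofReal_le_ofReal h2).trans ENNReal.ofReal_add_le).trans ?_
  gcongr
  exact le_iSup (fun q : ℚ => ENNReal.ofReal ((domPoint (truncDivergence φ L) q - 1) * y' -
    l * (truncDivergence φ L (domPoint (truncDivergence φ L) q)).toReal)) q

theorem conjExcess_zero {l : ℝ} (hl : 0 ≤ l) : conjExcess φ l 0 = 0 := by
  simp only [conjExcess, mul_zero, zero_sub, ENNReal.iSup_eq_zero, ENNReal.ofReal_eq_zero]
  exact fun q => neg_nonpos.2 (mul_nonneg hl ENNReal.toReal_nonneg)

theorem conjExcess_trunc_le (hφ : IsDivergence φ) (hL : 1 ≤ L) {l : ℝ} (hl : 0 ≤ l) (y : ℝ) :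
    conjExcess (truncDivergence φ L) l y ≤ ENNReal.ofReal (L * |y|) := by
  simpa [conjExcess_zero hl] using conjExcess_trunc_le_add hφ hL l y 0

theorem conjExcess_trunc_ne_top (hφ : IsDivergence φ) (hL : 1 ≤ L) {l : ℝ} (hl : 0 ≤ l) (y : ℝ) :
    conjExcess (truncDivergence φ L) l y ≠ ⊤ :=
  ne_top_of_le_ne_top ENNReal.ofReal_ne_top (conjExcess_trunc_le hφ hL hl y)

variable {Ω : Type*} [MeasurableSpace Ω] {P : Measure Ω} {B τ : ℝ} {X : Ω → ℝ}

/-- A bounded measurable selection dominating finitely many terms of `conjExcess`. -/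
theorem exists_selection (hφ : IsDivergence φ) (l : ℝ) {Y : Ω → ℝ} (hY : Measurable Y)
    (s : Finset ℚ) :
    ∃ (ζ : Ω → ℝ) (C : ℝ), Measurable ζ ∧ (∀ ω, 0 ≤ ζ ω ∧ ζ ω ≤ C) ∧
      (∀ ω, φ (ζ ω) ≤ ENNReal.ofReal C) ∧
      (∀ ω, 0 ≤ (ζ ω - 1) * Y ω - l * (φ (ζ ω)).toReal) ∧
      ∀ q ∈ s, ∀ ω, (domPoint φ q - 1) * Y ω - l * (φ (domPoint φ q)).toReal
        ≤ (ζ ω - 1) * Y ω - l * (φ (ζ ω)).toReal := by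
  induction s using Finset.induction_on with
  | empty =>
    exact ⟨fun _ => 1, 1, measurable_const, by simp, by simp [hφ.one], by simp [hφ.one], by simp⟩
  | insert q s _ ih =>
    obtain ⟨ζ, C, hm, hb, hC, h0, hs⟩ := ih
    set c := domPoint φ q with hc
    have hct : φ c ≠ ⊤ := hφ.domPoint_ne_top q
    have hφm := hφ.measurable
    have hA : MeasurableSet {ω | (ζ ω - 1) * Y ω - l * (φ (ζ ω)).toReal
        ≤ (c - 1) * Y ω - l * (φ c).toReal} :=
      measurableSet_le (by fun_prop) (by fun_prop)
    classical
    refine ⟨fun ω => if (ζ ω - 1) * Y ω - l * (φ (ζ ω)).toReal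
        ≤ (c - 1) * Y ω - l * (φ c).toReal then c else ζ ω, max C (max c (φ c).toReal),
      Measurable.ite hA measurable_const hm, ?_, ?_, ?_, ?_⟩
    · intro ω
      beta_reduce
      split_ifs
      · exact ⟨hφ.nonneg_of_ne_top hct, by simp⟩
      · exact ⟨(hb ω).1, (hb ω).2.trans (le_max_left _ _)⟩
    · intro ω
      beta_reduce
      split_ifs
      · exact (ENNReal.le_ofReal_iff_toReal_le hct ((hφ.nonneg_of_ne_top hct).trans (by simp))).2
          (by simp)
      · exact (hC ω).trans (ENNReal.ofReal_le_ofReal (le_max_left _ _))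
    · intro ω
      beta_reduce
      split_ifs with h
      · exact (h0 ω).trans h
      · exact h0 ω
    · intro p hp ω
      beta_reduce
      rcases Finset.mem_insert.1 hp with rfl | hp
      · split_ifs with h
        · exact le_rfl
        · exact (not_le.1 h).le
      · split_ifs with h
        · exact (hs p hp ω).trans h
        · exact hs p hp ω

/-- Strong duality with attainment. -/
theorem exists_dual [IsProbabilityMeasure P] (hφ : IsDivergence φ) (hτ : 0 < τ)
    (hX : Measurable X) (hB : 0 ≤ B) (hXB : ∀ ω, |X ω| ≤ B) :
    ∃ l μ : ℝ, 0 ≤ l ∧ |μ| ≤ B ∧ ∫ ω, X ω ∂P + l * τ ≤ robustRisk φ τ P X ∧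
      ∫⁻ ω, conjExcess φ l (X ω - μ) ∂P
        ≤ ENNReal.ofReal (robustRisk φ τ P X - l * τ - ∫ ω, X ω ∂P) := by
  obtain ⟨l, μ, hl, hμ, h⟩ := exists_multipliers (P := P) hφ hτ hX hB hXB
  refine ⟨l, μ, hl, hμ, ?_, ?_⟩
  · have := h (fun _ => 1) 0 measurable_const (fun _ => zero_le_one) (integrable_const 1) le_rfl
      (by simp [hφ.one])
    simp only [mul_one, mul_zero, sub_zero, integral_const, probReal_univ, smul_eq_mul] at this
    linarith
  have hXi : Integrable X P := by
    simpa using integrable_mul_of_bounded hX hXB (integrable_const (1 : ℝ))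
  set F : ℚ → Ω → ℝ≥0∞ := fun q ω =>
    ENNReal.ofReal ((domPoint φ q - 1) * (X ω - μ) - l * (φ (domPoint φ q)).toReal) with hF
  have hFm : ∀ q, Measurable (F q) := fun q => by fun_prop
  have hsup : ∀ ω, conjExcess φ l (X ω - μ) = ⨆ s : Finset ℚ, ⨆ q ∈ s, F q ω := fun ω =>
    iSup_eq_iSup_finset _
  simp_rw [hsup]
  -- Monotone convergence over finite sets of rationals replaces a measurable selection for the full
  -- supremum. Each finite maximum is dominated by a bounded `ζ`, which is tested in the multiplier
  -- inequality with its own divergence as budget.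
  rw [lintegral_iSup_directed]
  · refine iSup_le fun s => ?_
    obtain ⟨ζ, C, hm, hb, hC, h0, hs⟩ := exists_selection hφ l (hX.sub_const μ) s
    have hφm : Measurable fun ω => φ (ζ ω) := hφ.measurable.comp hm
    have hζi : Integrable ζ P := Integrable.of_bound hm.aestronglyMeasurable C
      (ae_of_all _ fun ω => by
        rw [Real.norm_of_nonneg (hb ω).1]; exact (hb ω).2)
    have hC0 : ∀ ω : Ω, 0 ≤ C := fun ω => (hb ω).1.trans (hb ω).2
    have hφi : Integrable (fun ω => (φ (ζ ω)).toReal) P :=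
      Integrable.of_bound hφm.ennreal_toReal.aestronglyMeasurable C
        (ae_of_all _ fun ω => by
          rw [Real.norm_of_nonneg ENNReal.toReal_nonneg]
          exact ENNReal.toReal_le_of_le_ofReal (hC0 ω) (hC ω))
    have hXζ := integrable_mul_of_bounded hX hXB hζi
    have hb' := h ζ (∫ ω, (φ (ζ ω)).toReal ∂P) hm (fun ω => (hb ω).1) hζi
      (integral_nonneg fun _ => ENNReal.toReal_nonneg) (by
        rw [ofReal_integral_eq_lintegral_ofReal hφi (ae_of_all _ fun _ => ENNReal.toReal_nonneg)]
        refine lintegral_mono fun ω => ?_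
        rw [ENNReal.ofReal_toReal (ne_top_of_le_ne_top ENNReal.ofReal_ne_top (hC ω))])
    have hexp : ∀ ω, (ζ ω - 1) * (X ω - μ) - l * (φ (ζ ω)).toReal
        = X ω * ζ ω - μ * ζ ω - X ω + μ - l * (φ (ζ ω)).toReal := fun ω => by ring
    have hi1 : Integrable (fun ω => X ω * ζ ω - μ * ζ ω) P := hXζ.sub (hζi.const_mul μ)
    have hi2 : Integrable (fun ω => X ω * ζ ω - μ * ζ ω - X ω) P := hi1.sub hXi
    have hi3 : Integrable (fun ω => X ω * ζ ω - μ * ζ ω - X ω + μ) P := hi2.add (integrable_const μ)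
    have hi4 := hi3.sub (hφi.const_mul l)
    have hint : ∫ ω, ((ζ ω - 1) * (X ω - μ) - l * (φ (ζ ω)).toReal) ∂P
        = ∫ ω, X ω * ζ ω ∂P - μ * ∫ ω, ζ ω ∂P - ∫ ω, X ω ∂P + μ
          - l * ∫ ω, (φ (ζ ω)).toReal ∂P := by
      simp_rw [hexp]
      rw [integral_sub hi3 (hφi.const_mul l), integral_add hi2 (integrable_const μ),
        integral_sub hi1 hXi, integral_sub hXζ (hζi.const_mul μ), integral_const_mul,
        integral_const_mul]
      simp
    calc ∫⁻ ω, ⨆ q ∈ s, F q ω ∂P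
        ≤ ∫⁻ ω, ENNReal.ofReal ((ζ ω - 1) * (X ω - μ) - l * (φ (ζ ω)).toReal) ∂P :=
          lintegral_mono fun ω => iSup₂_le fun q hq => ENNReal.ofReal_le_ofReal (hs q hq ω)
      _ = ENNReal.ofReal (∫ ω, ((ζ ω - 1) * (X ω - μ) - l * (φ (ζ ω)).toReal) ∂P) := by
          rw [ofReal_integral_eq_lintegral_ofReal _ (ae_of_all _ h0)]
          simp_rw [hexp]
          exact hi4
      _ ≤ _ := by
          refine ENNReal.ofReal_le_ofReal ?_
          rw [hint]
          linarith
  · exact fun s => (Measurable.biSup (s : Set ℚ) s.countable_toSet fun q _ => hFm q).aemeasurable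
  · refine Monotone.directed_le fun s t hst ω => ?_
    exact iSup₂_le fun q hq => le_iSup₂_of_le q (hst hq) le_rfl

end Conjugate

/-! ### The empirical problem: duality, measurability and bias -/

section Empirical

variable {Ω : Type*} [MeasurableSpace Ω] {B τ : ℝ} {X : Ω → ℝ} {φ : ℝ → ℝ≥0∞} {n : ℕ}

theorem isProbabilityMeasure_empiricalDist (hn : 0 < n) (s : Fin n → Ω) :
    IsProbabilityMeasure (empiricalDist s) := by
  constructor
  have h0 : (n : ℝ≥0∞) ≠ 0 := by exact_mod_cast hn.ne'
  simp [empiricalDist, ENNReal.inv_mul_cancel h0]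

theorem lintegral_empiricalDist (s : Fin n → Ω) {f : Ω → ℝ≥0∞} (hf : Measurable f) :
    ∫⁻ ω, f ω ∂(empiricalDist s) = (n : ℝ≥0∞)⁻¹ * ∑ i, f (s i) := by
  rw [empiricalDist, lintegral_smul_measure, lintegral_finsetSum_measure]
  simp [lintegral_dirac' _ hf]

theorem integral_empiricalDist (s : Fin n → Ω) {f : Ω → ℝ} (hf : Measurable f) :
    ∫ ω, f ω ∂(empiricalDist s) = (∑ i, f (s i)) / n := by
  rw [empiricalDist, integral_smul_measure, integral_finsetSum_measure]
  · simp [integral_dirac' _ _ hf.stronglyMeasurable, div_eq_inv_mul]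
  · intro i _
    exact (integrable_dirac' hf.stronglyMeasurable) (by simp)

/-- The values at the sample points of the elements of the ambiguity set. -/
def sampleWeights (φ : ℝ → ℝ≥0∞) (τ : ℝ) (n : ℕ) : Set (Fin n → ℝ) :=
  {z | (∀ i, φ (z i) ≠ ⊤) ∧ ∑ i, z i = n ∧ ∑ i, (φ (z i)).toReal ≤ n * τ}

theorem comp_mem_sampleWeights (hφ : IsDivergence φ) (hn : 0 < n) (hτ : 0 < τ) {s : Fin n → Ω}
    {ζ : Ω → ℝ} (hζ : ζ ∈ ambiguitySet φ τ (empiricalDist s)) :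
    (fun i => ζ (s i)) ∈ sampleWeights φ τ n := by
  have hn0 : (n : ℝ≥0∞) ≠ 0 := by exact_mod_cast hn.ne'
  have hn1 : (0 : ℝ) < n := by exact_mod_cast hn
  have h2 : ∑ i, φ (ζ (s i)) ≤ ENNReal.ofReal (n * τ) := by
    have := hζ.2
    rw [lintegral_empiricalDist s (f := fun ω => φ (ζ ω)) (hφ.measurable.comp hζ.1.measurable)] at this
    calc ∑ i, φ (ζ (s i)) = n * ((n : ℝ≥0∞)⁻¹ * ∑ i, φ (ζ (s i))) := by
          rw [← mul_assoc, ENNReal.mul_inv_cancel hn0 (ENNReal.natCast_ne_top n), one_mul]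
      _ ≤ n * ENNReal.ofReal τ := by gcongr
      _ = _ := by rw [ENNReal.ofReal_mul hn1.le, ENNReal.ofReal_natCast]
  have hfin : ∀ i, φ (ζ (s i)) ≠ ⊤ := fun i => ne_top_of_le_ne_top ENNReal.ofReal_ne_top
    ((Finset.single_le_sum (f := fun i => φ (ζ (s i))) (fun _ _ => zero_le)
      (Finset.mem_univ i)).trans h2)
  refine ⟨hfin, ?_, ?_⟩
  · have h1 := hζ.1.integral_eq_one
    rw [integral_empiricalDist s hζ.1.measurable] at h1
    field_simp at h1
    exact h1
  · rw [← ENNReal.toReal_sum fun i _ => hfin i]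
    exact ENNReal.toReal_le_of_le_ofReal (by positivity) h2

/-- Weak duality at a sample. -/
theorem sum_mul_le_of_mem_sampleWeights (hφ : IsDivergence φ) (hn : 0 < n) {x z : Fin n → ℝ}
    (hz : z ∈ sampleWeights φ τ n) {l μ : ℝ} (hl : 0 ≤ l)
    (hfin : ∀ i, conjExcess φ l (x i - μ) ≠ ⊤) :
    (∑ i, x i * z i) / n
      ≤ (∑ i, (x i + (conjExcess φ l (x i - μ)).toReal)) / n + l * τ := by
  have hn1 : (0 : ℝ) < n := by exact_mod_cast hn
  have h : ∑ i, ((z i - 1) * (x i - μ) - l * (φ (z i)).toReal)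
      ≤ ∑ i, (conjExcess φ l (x i - μ)).toReal :=
    Finset.sum_le_sum fun i _ => hφ.le_toReal_conjExcess hl (hz.1 i) (hfin i)
  have e : ∑ i, ((z i - 1) * (x i - μ) - l * (φ (z i)).toReal)
      = ∑ i, x i * z i - ∑ i, x i - μ * (∑ i, z i - n) - l * ∑ i, (φ (z i)).toReal := by
    have : (n : ℝ) = ∑ _i : Fin n, (1 : ℝ) := by simp
    rw [this, Finset.mul_sum, ← Finset.sum_sub_distrib, ← Finset.sum_sub_distrib, Finset.mul_sum,
      ← Finset.sum_sub_distrib, ← Finset.sum_sub_distrib]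
    exact Finset.sum_congr rfl fun i _ => by ring
  rw [e, hz.2.1, sub_self, mul_zero, sub_zero] at h
  have h3 := mul_le_mul_of_nonneg_left hz.2.2 hl
  rw [Finset.sum_add_distrib, div_add' _ _ _ hn1.ne', div_le_div_iff_of_pos_right hn1]
  linarith

theorem empiricalRisk_le (hφ : IsDivergence φ) (hX : Measurable X) (hn : 0 < n) (hτ : 0 < τ)
    (s : Fin n → Ω) {l μ : ℝ} (hl : 0 ≤ l) (hfin : ∀ i, conjExcess φ l (X (s i) - μ) ≠ ⊤) :
    empiricalRisk φ τ X s
      ≤ (∑ i, (X (s i) + (conjExcess φ l (X (s i) - μ)).toReal)) / n + l * τ := by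
  have := isProbabilityMeasure_empiricalDist hn s
  refine robustRisk_le hφ fun ζ hζ => ?_
  rw [integral_empiricalDist s (f := fun ω => X ω * ζ ω) (hX.mul hζ.1.measurable)]
  exact sum_mul_le_of_mem_sampleWeights (x := fun i => X (s i)) hφ hn
    (comp_mem_sampleWeights hφ hn hτ hζ) hl hfin

/-- Strong duality at a sample. -/
theorem exists_dual_empirical (hφ : IsDivergence φ) (hX : Measurable X) (hn : 0 < n)
    (hτ : 0 < τ) (hB : 0 ≤ B) (hXB : ∀ ω, |X ω| ≤ B) (s : Fin n → Ω) :
    ∃ l μ : ℝ, 0 ≤ l ∧ |μ| ≤ B ∧ l * τ ≤ 2 * B ∧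
      (∀ i, conjExcess φ l (X (s i) - μ) ≠ ⊤) ∧
      (∑ i, (X (s i) + (conjExcess φ l (X (s i) - μ)).toReal)) / n + l * τ
        ≤ empiricalRisk φ τ X s := by
  have := isProbabilityMeasure_empiricalDist hn s
  have hn0 : (n : ℝ≥0∞) ≠ 0 := by exact_mod_cast hn.ne'
  have hn1 : (0 : ℝ) < n := by exact_mod_cast hn
  obtain ⟨l, μ, hl, hμ, h1, h2⟩ := exists_dual (P := empiricalDist s) hφ hτ hX hB hXB
  set R := robustRisk φ τ (empiricalDist s) X
  set E := ∫ ω, X ω ∂(empiricalDist s) with hE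
  have hR : R ≤ B := (abs_le.1 (abs_robustRisk_le hφ hX hXB)).2
  have hE' : -B ≤ E := by
    have := (one_mem_ambiguitySet (P := empiricalDist s) hφ τ).1.abs_integral_mul_le hX hXB
    simpa using (abs_le.1 this).1
  rw [lintegral_empiricalDist s (f := fun ω => conjExcess φ l (X ω - μ)) (by fun_prop)] at h2
  have h3 : ∑ i, conjExcess φ l (X (s i) - μ) ≤ ENNReal.ofReal (n * (R - l * τ - E)) := by
    calc ∑ i, conjExcess φ l (X (s i) - μ)
        = n * ((n : ℝ≥0∞)⁻¹ * ∑ i, conjExcess φ l (X (s i) - μ)) := by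
          rw [← mul_assoc, ENNReal.mul_inv_cancel hn0 (ENNReal.natCast_ne_top n), one_mul]
      _ ≤ n * ENNReal.ofReal (R - l * τ - E) := by gcongr
      _ = _ := by rw [ENNReal.ofReal_mul hn1.le, ENNReal.ofReal_natCast]
  have hfin : ∀ i, conjExcess φ l (X (s i) - μ) ≠ ⊤ := fun i =>
    ne_top_of_le_ne_top ENNReal.ofReal_ne_top
      ((Finset.single_le_sum (f := fun i => conjExcess φ l (X (s i) - μ)) (fun _ _ => zero_le)
        (Finset.mem_univ i)).trans h3)
  refine ⟨l, μ, hl, hμ, by linarith, hfin, ?_⟩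
  have h4 := ENNReal.toReal_le_of_le_ofReal
    (mul_nonneg hn1.le (by linarith : 0 ≤ R - l * τ - E)) h3
  rw [ENNReal.toReal_sum fun i _ => hfin i] at h4
  rw [integral_empiricalDist s hX] at hE
  change _ ≤ R
  rw [Finset.sum_add_distrib, add_div, ← hE]
  have h5 : (∑ i, (conjExcess φ l (X (s i) - μ)).toReal) / n ≤ R - l * τ - E := by
    rw [div_le_iff₀ hn1]; linarith
  linarith

/-- A weight vector may give different weights to coinciding or measurably inseparable sample
points, and then comes from no `ζ`. Weak duality for vectors and strong duality for densities show
that allowing such vectors does not raise the supremum. -/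
theorem isLUB_empiricalRisk (hφ : IsDivergence φ) (hX : Measurable X) (hn : 0 < n)
    (hτ : 0 < τ) (hB : 0 ≤ B) (hXB : ∀ ω, |X ω| ≤ B) (s : Fin n → Ω) :
    IsLUB (Set.range fun z : sampleWeights φ τ n => (∑ i, X (s i) * z.1 i) / n)
      (empiricalRisk φ τ X s) := by
  obtain ⟨l, μ, hl, -, -, hfin, hd⟩ := exists_dual_empirical hφ hX hn hτ hB hXB s
  refine ⟨?_, fun c hc => ?_⟩
  · rintro _ ⟨z, rfl⟩
    exact (sum_mul_le_of_mem_sampleWeights (x := fun i => X (s i)) hφ hn z.2 hl hfin).trans hd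
  · have := isProbabilityMeasure_empiricalDist hn s
    refine robustRisk_le hφ fun ζ hζ => ?_
    rw [integral_empiricalDist s (f := fun ω => X ω * ζ ω) (hX.mul hζ.1.measurable)]
    exact hc ⟨⟨_, comp_mem_sampleWeights hφ hn hτ hζ⟩, rfl⟩

/-- The set of weights does not depend on the sample, so the risk is a supremum of linear functions
of the values `X (s i)`: its strict superlevel sets are preimages of open sets. -/
theorem measurable_empiricalRisk (hφ : IsDivergence φ) (hX : Measurable X) (hn : 0 < n)
    (hτ : 0 < τ) (hB : 0 ≤ B) (hXB : ∀ ω, |X ω| ≤ B) :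
    Measurable fun s : Fin n → Ω => empiricalRisk φ τ X s := by
  refine measurable_of_Ioi fun c => ?_
  have hopen : IsOpen (⋃ z : sampleWeights φ τ n, {x : Fin n → ℝ | c < (∑ i, x i * z.1 i) / n}) :=
    isOpen_iUnion fun z => isOpen_lt (by fun_prop) (by fun_prop)
  have hXs : Measurable fun s : Fin n → Ω => fun i => X (s i) := by fun_prop
  convert hXs hopen.measurableSet using 1
  ext s
  simp [lt_isLUB_iff (isLUB_empiricalRisk hφ hX hn hτ hB hXB s)]

theorem abs_empiricalRisk_le (hφ : IsDivergence φ) (hX : Measurable X) (hn : 0 < n)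
    (hXB : ∀ ω, |X ω| ≤ B) (s : Fin n → Ω) : |empiricalRisk φ τ X s| ≤ B := by
  have := isProbabilityMeasure_empiricalDist hn s
  exact abs_robustRisk_le hφ hX hXB

variable {P : Measure Ω} [IsProbabilityMeasure P]

theorem integrable_empiricalRisk (hφ : IsDivergence φ) (hX : Measurable X) (hn : 0 < n)
    (hτ : 0 < τ) (hB : 0 ≤ B) (hXB : ∀ ω, |X ω| ≤ B) :
    Integrable (fun s : Fin n → Ω => empiricalRisk φ τ X s) (Measure.pi fun _ : Fin n => P) :=
  Integrable.of_bound (measurable_empiricalRisk hφ hX hn hτ hB hXB).aestronglyMeasurable B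
    (ae_of_all _ fun s => abs_empiricalRisk_le hφ hX hn hXB s)

/-- The sample average approximation is biased downwards. -/
theorem integral_empiricalRisk_le (hφ : IsDivergence φ) (hX : Measurable X) (hn : 0 < n)
    (hτ : 0 < τ) (hB : 0 ≤ B) (hXB : ∀ ω, |X ω| ≤ B) :
    ∫ s : Fin n → Ω, empiricalRisk φ τ X s ∂(Measure.pi fun _ : Fin n => P)
      ≤ robustRisk φ τ P X := by
  have hn1 : (0 : ℝ) < n := by exact_mod_cast hn
  -- One pair of multipliers, optimal for `P`, serves every sample. Without truncation `H` may be
  -- infinite, but only on a null set.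
  obtain ⟨l, μ, hl, -, h1, h2⟩ := exists_dual (P := P) hφ hτ hX hB hXB
  set R := robustRisk φ τ P X
  set H : Ω → ℝ≥0∞ := fun ω => conjExcess φ l (X ω - μ) with hH
  have hHm : Measurable H := by fun_prop
  have hHfin : ∫⁻ ω, H ω ∂P ≠ ⊤ := ne_top_of_le_ne_top ENNReal.ofReal_ne_top h2
  have hHae : ∀ᵐ ω ∂P, H ω ≠ ⊤ := (ae_lt_top hHm hHfin).mono fun _ h => h.ne
  have hHi : Integrable (fun ω => (H ω).toReal) P :=
    integrable_toReal_of_lintegral_ne_top hHm.aemeasurable hHfin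
  have hHint : ∫ ω, (H ω).toReal ∂P ≤ R - l * τ - ∫ ω, X ω ∂P := by
    rw [integral_toReal hHm.aemeasurable (ae_lt_top hHm hHfin)]
    exact ENNReal.toReal_le_of_le_ofReal (by linarith) h2
  have hXi : Integrable X P := by
    simpa using integrable_mul_of_bounded hX hXB (integrable_const (1 : ℝ))
  set f : Ω → ℝ := fun ω => X ω + (H ω).toReal with hf
  have hfi : Integrable f P := hXi.add hHi
  have hae : ∀ᵐ s ∂(Measure.pi fun _ : Fin n => P), ∀ i, H (s i) ≠ ⊤ :=
    ae_all_iff.2 fun i => (measurePreserving_eval (fun _ : Fin n => P) i).quasiMeasurePreserving.ae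
      hHae
  have hfs : ∀ i, Integrable (fun s : Fin n → Ω => f (s i)) (Measure.pi fun _ : Fin n => P) :=
    fun i => (measurePreserving_eval (fun _ : Fin n => P) i).integrable_comp_of_integrable hfi
  have hfe : ∀ i, ∫ s : Fin n → Ω, f (s i) ∂(Measure.pi fun _ : Fin n => P) = ∫ ω, f ω ∂P :=
    fun i => by
      have := (measurePreserving_eval (fun _ : Fin n => P) i).map_eq
      conv_rhs => rw [← this]
      rw [integral_map (measurable_pi_apply i).aemeasurable]
      rw [this]
      exact hfi.aestronglyMeasurable
  have hsum := integrable_finsetSum Finset.univ fun i _ => hfs i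
  calc ∫ s : Fin n → Ω, empiricalRisk φ τ X s ∂(Measure.pi fun _ : Fin n => P)
      ≤ ∫ s : Fin n → Ω, ((∑ i, f (s i)) / n + l * τ) ∂(Measure.pi fun _ : Fin n => P) := by
        refine integral_mono_ae (integrable_empiricalRisk hφ hX hn hτ hB hXB)
          ((hsum.div_const _).add (integrable_const _)) ?_
        filter_upwards [hae] with s hs
        exact empiricalRisk_le hφ hX hn hτ s hl hs
    _ = ∫ ω, f ω ∂P + l * τ := by
        rw [integral_add (hsum.div_const _) (integrable_const _), integral_div,
          integral_finsetSum _ fun i _ => hfs i]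
        simp [hfe, hn1.ne']
    _ = ∫ ω, X ω ∂P + ∫ ω, (H ω).toReal ∂P + l * τ := by rw [hf, integral_add hXi hHi]
    _ ≤ R := by linarith

end Empirical

/-! ### Bounds for the truncated dual integrand -/

section DualIntegrand

variable {Ω : Type*} {B τ ε L : ℝ} {X : Ω → ℝ} {φ : ℝ → ℝ≥0∞}

/-- The integrand of the dual problem for the truncated divergence. -/
noncomputable def dualIntegrand (φ : ℝ → ℝ≥0∞) (L : ℝ) (X : Ω → ℝ) (l μ : ℝ) (ω : Ω) : ℝ :=
  X ω + (conjExcess (truncDivergence φ L) l (X ω - μ)).toReal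

/-- `X` lies in `[-B, B]` and the excess in `[0, 2BL]`, so an interval of length `(2 + 2L)B` would
already do. -/
theorem dualIntegrand_mem (hφ : IsDivergence φ) (hL : 1 ≤ L) (hXB : ∀ ω, |X ω| ≤ B) (hB : 0 ≤ B)
    {l μ : ℝ} (hl : 0 ≤ l) (hμ : |μ| ≤ B) (ω : Ω) :
    dualIntegrand φ L X l μ ω ∈ Set.Icc (-B) (-B + boundConst B L) := by
  have h0 : (0 : ℝ) ≤ (conjExcess (truncDivergence φ L) l (X ω - μ)).toReal :=
    ENNReal.toReal_nonneg
  have h1 := ENNReal.toReal_le_of_le_ofReal (by positivity)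
    (conjExcess_trunc_le hφ hL hl (X ω - μ))
  have h2 : |X ω - μ| ≤ 2 * B := (abs_sub _ _).trans (by linarith [hXB ω])
  have h3 : L * |X ω - μ| ≤ L * (2 * B) := by gcongr
  have h4 := abs_le.1 (hXB ω)
  unfold dualIntegrand boundConst
  constructor <;> nlinarith

/-- One-sided on purpose: raising `l` only lowers the integrand, so only the shift of `μ` is paid
for. -/
theorem dualIntegrand_le_add (hφ : IsDivergence φ) (hL : 1 ≤ L) {l l' μ μ' v : ℝ}
    (hl : 0 ≤ l) (hll' : l ≤ l') (hμ : |μ - μ'| ≤ v) (ω : Ω) :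
    dualIntegrand φ L X l' μ' ω ≤ dualIntegrand φ L X l μ ω + L * v := by
  have hv : 0 ≤ v := (abs_nonneg _).trans hμ
  have h1 := (conjExcess_antitone hll' (X ω - μ')).trans
    (conjExcess_trunc_le_add hφ hL l (X ω - μ') (X ω - μ))
  rw [sub_sub_sub_cancel_left] at h1
  have h2 := h1.trans (add_le_add_right (ENNReal.ofReal_le_ofReal
    (mul_le_mul_of_nonneg_left hμ (by linarith : 0 ≤ L))) _)
  have h3 := ENNReal.toReal_mono (ENNReal.add_ne_top.2
    ⟨conjExcess_trunc_ne_top hφ hL hl _, ENNReal.ofReal_ne_top⟩) h2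
  rw [ENNReal.toReal_add (conjExcess_trunc_ne_top hφ hL hl _) ENNReal.ofReal_ne_top,
    ENNReal.toReal_ofReal (by positivity)] at h3
  unfold dualIntegrand
  linarith

/-- The left side bounds the number of events in the later union bound: the grid plus one extra
event. Of `lipConst` only the part `L + 1 + τ` matters, through `4 (L + 1) τ ≤ (L + 1 + τ)²`; the
rest is arithmetic in `B / ε > 1/2`. -/
theorem card_grid_le (hτ : 0 < τ) (hε : 0 < ε) (hBε : ε < 2 * B) (hL : 1 ≤ L) :
    (16 * B / ε + 2) * (32 * B * L / ε + 1) + 1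
      ≤ 256 * B ^ 2 * lipConst B τ ε L ^ 2 / (τ * ε ^ 2) := by
  have hB : 0 < B := by linarith
  have h1 : L + 1 + τ ≤ lipConst B τ ε L := by
    have : 0 ≤ 2 * (1 + L) * B / lambdaLow τ ε := by unfold lambdaLow; positivity
    unfold lipConst
    linarith
  have h2 : 4 * (L + 1) * τ ≤ lipConst B τ ε L ^ 2 := by
    have : (L + 1 + τ) ^ 2 ≤ lipConst B τ ε L ^ 2 := by gcongr
    nlinarith [sq_nonneg (L + 1 - τ)]
  obtain ⟨b, hb⟩ : ∃ b, b = B / ε := ⟨_, rfl⟩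
  have hb2 : 1 / 2 < b := by rw [hb, lt_div_iff₀ hε]; linarith
  have e1 : 16 * B / ε = 16 * b := by rw [hb]; ring
  have e2 : 32 * B * L / ε = 32 * b * L := by rw [hb]; ring
  rw [e1, e2]
  calc (16 * b + 2) * (32 * b * L + 1) + 1 ≤ (20 * b) * (34 * (b * L)) + 4 * b * (b * L) := by
        have hbL : 1 / 2 ≤ b * L := by nlinarith
        have h3 : (16 * b + 2) * (32 * b * L + 1) ≤ (20 * b) * (34 * (b * L)) := by
          apply mul_le_mul <;> nlinarith
        nlinarith
    _ ≤ 1024 * b ^ 2 * (L + 1) := by nlinarith [sq_nonneg b]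
    _ = 256 * B ^ 2 * (4 * (L + 1) * τ) / (τ * ε ^ 2) := by rw [hb]; field_simp; ring
    _ ≤ _ := by gcongr

end DualIntegrand

/-! ### Hoeffding bounds and the grid of multipliers -/

section Concentration

variable {Ω : Type*} [MeasurableSpace Ω] {P : Measure Ω} [IsProbabilityMeasure P]

/-- One-sided Hoeffding inequality for the sample mean. -/
theorem hoeffding_sample_mean {f : Ω → ℝ} (hf : Measurable f) {a M t : ℝ}
    (hab : ∀ ω, f ω ∈ Set.Icc a (a + M)) (hM : 0 < M) (ht : 0 ≤ t) {n : ℕ} (hn : 0 < n) :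
    (Measure.pi fun _ : Fin n => P).real {s | ∫ ω, f ω ∂P + t ≤ (∑ i, f (s i)) / n}
      ≤ Real.exp (-(2 * n * t ^ 2 / M ^ 2)) := by
  have hn1 : (0 : ℝ) < n := by exact_mod_cast hn
  have hsub := ProbabilityTheory.hasSubgaussianMGF_of_mem_Icc (μ := P) hf.aemeasurable
    (ae_of_all _ hab)
  have hindep : ProbabilityTheory.iIndepFun (fun (i : Fin n) (s : Fin n → Ω) =>
      f (s i) - ∫ ω, f ω ∂P) (Measure.pi fun _ : Fin n => P) :=
    ProbabilityTheory.iIndepFun_pi (X := fun (_ : Fin n) ω => f ω - ∫ ω, f ω ∂P)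
      fun i => (hf.sub_const _).aemeasurable
  have hs : ∀ i ∈ (Finset.univ : Finset (Fin n)), ProbabilityTheory.HasSubgaussianMGF
      (fun s : Fin n → Ω => f (s i) - ∫ ω, f ω ∂P) ((‖a + M - a‖₊ / 2) ^ 2)
      (Measure.pi fun _ : Fin n => P) := fun i _ => by
    rw [← (measurePreserving_eval (fun _ : Fin n => P) i).map_eq] at hsub
    have h := hsub.of_map (measurePreserving_eval (fun _ : Fin n => P) i).measurable.aemeasurable
    rw [(measurePreserving_eval (fun _ : Fin n => P) i).map_eq] at h
    exact h
  have h := ProbabilityTheory.HasSubgaussianMGF.measure_sum_ge_le_of_iIndepFun hindep hs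
    (ε := n * t) (by positivity)
  convert h using 2
  · ext s
    simp only [Set.mem_ofPred_eq, Finset.sum_sub_distrib, Finset.sum_const, Finset.card_univ,
      Fintype.card_fin, nsmul_eq_mul]
    rw [le_div_iff₀ hn1]
    constructor <;> intro h <;> linarith
  · simp only [add_sub_cancel_left, Finset.sum_const, Finset.card_univ, Fintype.card_fin,
      nsmul_eq_mul, NNReal.coe_mul, NNReal.coe_natCast, NNReal.coe_pow, NNReal.coe_div,
      coe_nnnorm, Real.norm_of_nonneg hM.le, NNReal.coe_ofNat]
    field_simp

theorem hoeffding_sample_mean_lower {f : Ω → ℝ} (hf : Measurable f) {a M t : ℝ}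
    (hab : ∀ ω, f ω ∈ Set.Icc a (a + M)) (hM : 0 < M) (ht : 0 ≤ t) {n : ℕ} (hn : 0 < n) :
    (Measure.pi fun _ : Fin n => P).real {s | (∑ i, f (s i)) / n + t ≤ ∫ ω, f ω ∂P}
      ≤ Real.exp (-(2 * n * t ^ 2 / M ^ 2)) := by
  have h := hoeffding_sample_mean (P := P) hf.neg (a := -(a + M)) (M := M) (t := t)
    (fun ω => ⟨neg_le_neg (hab ω).2, by
      have := (hab ω).1
      simp only [Pi.neg_apply]
      linarith⟩) hM ht hn
  convert h using 2
  ext s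
  simp only [Set.mem_ofPred_eq, Pi.neg_apply, integral_neg, Finset.sum_neg_distrib, neg_div]
  constructor <;> intro h <;> linarith

variable {B τ ε L δ : ℝ} {X : Ω → ℝ} {φ : ℝ → ℝ≥0∞}

/-- Integrate the Fenchel inequality `X ζ ≤ X + H_l(X - μ) + μ (ζ - 1) + l φ(ζ)`; the `μ` term
vanishes because `ζ` has mass `1`. -/
theorem robustRisk_le_dual (hφ : IsDivergence φ) (hX : Measurable X) (hXB : ∀ ω, |X ω| ≤ B)
    (hτ : 0 < τ) {l μ : ℝ} (hl : 0 ≤ l) (hfin : ∀ ω, conjExcess φ l (X ω - μ) ≠ ⊤)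
    (hi : Integrable (fun ω => X ω + (conjExcess φ l (X ω - μ)).toReal) P) :
    robustRisk φ τ P X ≤ ∫ ω, (X ω + (conjExcess φ l (X ω - μ)).toReal) ∂P + l * τ := by
  refine robustRisk_le hφ fun ζ hζ => ?_
  have hm : Measurable fun ω => φ (ζ ω) := hφ.measurable.comp hζ.1.measurable
  have hne : ∫⁻ ω, φ (ζ ω) ∂P ≠ ⊤ := ne_top_of_le_ne_top ENNReal.ofReal_ne_top hζ.2
  have hφi : Integrable (fun ω => (φ (ζ ω)).toReal) P :=
    integrable_toReal_of_lintegral_ne_top hm.aemeasurable hne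
  have hφτ : ∫ ω, (φ (ζ ω)).toReal ∂P ≤ τ := by
    rw [integral_toReal hm.aemeasurable (ae_lt_top hm hne)]
    exact ENNReal.toReal_le_of_le_ofReal hτ.le hζ.2
  have hζi := hζ.1.integrable
  have hc : Integrable (fun ω => μ * (ζ ω - 1)) P := (hζi.sub (integrable_const 1)).const_mul μ
  have hic : Integrable (fun ω => X ω + (conjExcess φ l (X ω - μ)).toReal + μ * (ζ ω - 1)) P :=
    hi.add hc
  calc ∫ ω, X ω * ζ ω ∂P
      ≤ ∫ ω, (X ω + (conjExcess φ l (X ω - μ)).toReal + μ * (ζ ω - 1)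
          + l * (φ (ζ ω)).toReal) ∂P := by
        refine integral_mono_ae (integrable_mul_of_bounded hX hXB hζi)
          (hic.add (hφi.const_mul l)) ?_
        filter_upwards [ae_lt_top hm hne] with ω hω
        have := hφ.le_toReal_conjExcess hl hω.ne (hfin ω)
        linarith
    _ = ∫ ω, (X ω + (conjExcess φ l (X ω - μ)).toReal) ∂P + l * ∫ ω, (φ (ζ ω)).toReal ∂P := by
        rw [integral_add hic (hφi.const_mul l), integral_add hi hc, integral_const_mul,
          integral_const_mul, integral_sub hζi (integrable_const 1), hζ.1.integral_eq_one]
        simp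
    _ ≤ _ := by gcongr

theorem measurable_dualIntegrand (hX : Measurable X) (l μ : ℝ) :
    Measurable (dualIntegrand φ L X l μ) := by
  unfold dualIntegrand
  fun_prop

theorem integrable_dualIntegrand (hφ : IsDivergence φ) (hL : 1 ≤ L) (hX : Measurable X)
    (hXB : ∀ ω, |X ω| ≤ B) (hB : 0 ≤ B) {l μ : ℝ} (hl : 0 ≤ l) (hμ : |μ| ≤ B) :
    Integrable (dualIntegrand φ L X l μ) P :=
  Integrable.of_mem_Icc _ _ (measurable_dualIntegrand hX l μ).aemeasurable
    (ae_of_all _ (dualIntegrand_mem hφ hL hXB hB hl hμ))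

/-- The lower error `ε/4` is `ε/16` for Hoeffding at a grid point, `ε/16` for rounding `μ` and `ε/8`
for rounding `l`. The upper error is a single Hoeffding deviation. -/
theorem exists_concentration_event (hφ : IsDivergence φ) (hτ : 0 < τ) (hX : Measurable X)
    (hXB : ∀ ω, |X ω| ≤ B) (hε : 0 < ε) (hBε : ε < 2 * B) (hL : 1 ≤ L) (hδ : 0 < δ)
    {n : ℕ} (hn : 0 < n)
    (hnn : 128 * boundConst B L ^ 2 *
      Real.log (256 * B ^ 2 * lipConst B τ ε L ^ 2 / (τ * ε ^ 2 * δ)) / ε ^ 2 ≤ (n : ℝ)) :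
    ∃ G : Set (Fin n → Ω), MeasurableSet G ∧ (Measure.pi fun _ : Fin n => P).real Gᶜ ≤ δ ∧
      ∀ s ∈ G, robustRisk (truncDivergence φ L) τ P X - ε / 4
          ≤ empiricalRisk (truncDivergence φ L) τ X s ∧
        empiricalRisk (truncDivergence φ L) τ X s
          ≤ robustRisk (truncDivergence φ L) τ P X + ε / 16 := by
  have hB : 0 < B := by linarith
  have hn1 : (0 : ℝ) < n := by exact_mod_cast hn
  have hφL := hφ.trunc hL
  set R := robustRisk (truncDivergence φ L) τ P X with hR
  set M := boundConst B L with hM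
  have hM0 : 0 < M := by rw [hM]; unfold boundConst; positivity
  set K := 256 * B ^ 2 * lipConst B τ ε L ^ 2 / (τ * ε ^ 2) with hK
  have hgrid : (16 * B / ε + 2) * (32 * B * L / ε + 1) + 1 ≤ K := card_grid_le hτ hε hBε hL
  have hK0 : 0 < K := lt_of_lt_of_le (by positivity) hgrid
  have hexp : Real.exp (-(2 * n * (ε / 16) ^ 2 / M ^ 2)) ≤ δ / K := by
    have e : 256 * B ^ 2 * lipConst B τ ε L ^ 2 / (τ * ε ^ 2 * δ) = K / δ := by
      rw [hK, div_div]
    rw [e, div_le_iff₀ (by positivity)] at hnn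
    rw [← Real.exp_log (by positivity : 0 < δ / K), Real.exp_le_exp, ← inv_div K δ,
      Real.log_inv, neg_le_neg_iff, le_div_iff₀ (by positivity)]
    linarith
  -- The mesh `w` for `l` costs `w τ = ε/8` in the term `l τ`; the mesh `v` for `μ` costs `L v =
  -- ε/16` in the integrand. `J` and `I` are the numbers of steps covering `l ≤ 2B/τ` and `μ ∈ [-B,
  -- B]`.
  set w := ε / (8 * τ) with hw
  have hw0 : 0 < w := by positivity
  have hwτ : w * τ = ε / 8 := by rw [hw]; field_simp
  set v := ε / (16 * L) with hv
  have hv0 : 0 < v := by positivity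
  have hLv : L * v = ε / 16 := by rw [hv]; field_simp
  set J := ⌈16 * B / ε⌉₊ with hJ
  set I := ⌊32 * B * L / ε⌋₊ with hI
  set gridFn : ℕ × ℕ → Ω → ℝ := fun p => dualIntegrand φ L X (p.1 * w) (-B + p.2 * v)
  set T : Finset (ℕ × ℕ) := Finset.range (J + 1) ×ˢ Finset.range (I + 1) with hT
  have hIv : (I : ℝ) * v ≤ 2 * B := by
    have h1 : (I : ℝ) ≤ 32 * B * L / ε := Nat.floor_le (by positivity)
    calc (I : ℝ) * v ≤ 32 * B * L / ε * v := by gcongr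
      _ = 2 * B := by rw [hv]; field_simp; ring
  have hμT : ∀ p ∈ T, |-B + (p.2 : ℝ) * v| ≤ B := by
    intro p hp
    have h2 : p.2 ≤ I := by
      have := (Finset.mem_product.1 hp).2
      rw [Finset.mem_range] at this
      omega
    have h3 : (p.2 : ℝ) * v ≤ I * v := by gcongr
    have h4 : 0 ≤ (p.2 : ℝ) * v := by positivity
    rw [abs_le]
    constructor <;> linarith
  have hcard : (T.card : ℝ) ≤ (16 * B / ε + 2) * (32 * B * L / ε + 1) := by
    rw [hT, Finset.card_product, Finset.card_range, Finset.card_range]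
    push_cast
    have h1 : (J : ℝ) < 16 * B / ε + 1 := Nat.ceil_lt_add_one (by positivity)
    have h2 : (I : ℝ) ≤ 32 * B * L / ε := Nat.floor_le (by positivity)
    gcongr ?_ * ?_ <;> linarith
  obtain ⟨l₀, μ₀, hl₀, hμ₀, hd1, hd2⟩ := exists_dual (P := P) hφL hτ hX hB.le hXB
  set f₀ := dualIntegrand φ L X l₀ μ₀ with hf₀
  have hf₀m : Measurable f₀ := measurable_dualIntegrand hX _ _
  have hf₀R : ∫ ω, f₀ ω ∂P + l₀ * τ ≤ R := by
    have hm : Measurable fun ω => conjExcess (truncDivergence φ L) l₀ (X ω - μ₀) := by fun_prop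
    have hfin : ∫⁻ ω, conjExcess (truncDivergence φ L) l₀ (X ω - μ₀) ∂P ≠ ⊤ :=
      ne_top_of_le_ne_top ENNReal.ofReal_ne_top hd2
    have hXi : Integrable X P := by
      simpa using integrable_mul_of_bounded hX hXB (integrable_const (1 : ℝ))
    have h1 : ∫ ω, f₀ ω ∂P = ∫ ω, X ω ∂P
        + ∫ ω, (conjExcess (truncDivergence φ L) l₀ (X ω - μ₀)).toReal ∂P :=
      integral_add hXi (integrable_toReal_of_lintegral_ne_top hm.aemeasurable hfin)
    rw [h1, integral_toReal hm.aemeasurable (ae_lt_top hm hfin)]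
    have := ENNReal.toReal_le_of_le_ofReal (by linarith) hd2
    linarith
  set bad₀ : Set (Fin n → Ω) := {s | ∫ ω, f₀ ω ∂P + ε / 16 ≤ (∑ i, f₀ (s i)) / n} with hbad₀
  set bad : ℕ × ℕ → Set (Fin n → Ω) := fun p =>
    {s | (∑ i, gridFn p (s i)) / n + ε / 16 ≤ ∫ ω, gridFn p ω ∂P} with hbad
  have hgm : ∀ p, Measurable (gridFn p) := fun p => measurable_dualIntegrand hX _ _
  have hbad₀m : MeasurableSet bad₀ := measurableSet_le (by fun_prop) (by fun_prop)
  have hbadm : ∀ p, MeasurableSet (bad p) := fun p => by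
    have := hgm p
    exact measurableSet_le (by fun_prop) (by fun_prop)
  refine ⟨(bad₀ ∪ ⋃ p ∈ T, bad p)ᶜ,
    (hbad₀m.union (T.measurableSet_biUnion fun p _ => hbadm p)).compl, ?_, ?_⟩
  · rw [compl_compl]
    have h0 : (Measure.pi fun _ : Fin n => P).real bad₀ ≤ δ / K :=
      (hoeffding_sample_mean hf₀m (dualIntegrand_mem hφ hL hXB hB.le hl₀ hμ₀) hM0
        (by positivity) hn).trans hexp
    have h1 : ∀ p ∈ T, (Measure.pi fun _ : Fin n => P).real (bad p) ≤ δ / K := fun p hp =>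
      (hoeffding_sample_mean_lower (hgm p)
        (dualIntegrand_mem hφ hL hXB hB.le (by positivity) (hμT p hp)) hM0
        (by positivity) hn).trans hexp
    calc (Measure.pi fun _ : Fin n => P).real (bad₀ ∪ ⋃ p ∈ T, bad p)
        ≤ (Measure.pi fun _ : Fin n => P).real bad₀
          + (Measure.pi fun _ : Fin n => P).real (⋃ p ∈ T, bad p) := measureReal_union_le _ _
      _ ≤ δ / K + ∑ p ∈ T, (Measure.pi fun _ : Fin n => P).real (bad p) :=
          add_le_add h0 (measureReal_biUnion_finset_le _ _)
      _ ≤ δ / K + T.card • (δ / K) := by gcongr; exact Finset.sum_le_card_nsmul _ _ _ h1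
      _ = (T.card + 1) * (δ / K) := by rw [nsmul_eq_mul]; ring
      _ ≤ K * (δ / K) := by gcongr; linarith
      _ = δ := mul_div_cancel₀ _ hK0.ne'
  · intro s hs
    simp only [Set.mem_compl_iff, Set.mem_union, Set.mem_iUnion, not_or, not_exists] at hs
    obtain ⟨hs0, hs1⟩ := hs
    refine ⟨?_, ?_⟩
    · obtain ⟨l, μ, hl, hμ, hlτ, -, hdual⟩ :=
        exists_dual_empirical hφL hX hn hτ hB.le hXB s
      -- The multipliers depend on the sample, hence the need for a uniform bound. `l` is rounded up
      -- for monotonicity; `μ` is rounded down so that the grid value stays in `[-B, B]`.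
      set j := ⌈l / w⌉₊ with hj
      set i := ⌊(μ + B) / v⌋₊ with hi
      have hμ' := abs_le.1 hμ
      have hμB : 0 ≤ (μ + B) / v := div_nonneg (by linarith) hv0.le
      have hlw : 0 ≤ l / w := by positivity
      have hmem : (j, i) ∈ T := by
        rw [hT, Finset.mem_product, Finset.mem_range, Finset.mem_range, Nat.lt_succ_iff,
          Nat.lt_succ_iff]
        refine ⟨Nat.ceil_mono ?_, Nat.floor_mono ?_⟩
        · rw [div_le_iff₀ hw0, hw]
          have : 16 * B / ε * (ε / (8 * τ)) = 2 * B / τ := by field_simp; ring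
          rw [this, le_div_iff₀ hτ]
          exact hlτ
        · rw [div_le_iff₀ hv0, hv]
          have : 32 * B * L / ε * (ε / (16 * L)) = 2 * B := by field_simp; ring
          linarith
      have hj1 : l ≤ j * w := (div_le_iff₀ hw0).1 (Nat.le_ceil _)
      have hj2 : j * w ≤ l + w := by
        have := mul_le_mul_of_nonneg_right (Nat.ceil_lt_add_one hlw).le hw0.le
        rwa [add_mul, one_mul, div_mul_cancel₀ _ hw0.ne'] at this
      have hi1 : i * v ≤ μ + B := (le_div_iff₀ hv0).1 (Nat.floor_le hμB)
      have hi2 : μ + B ≤ i * v + v := by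
        have := (div_le_iff₀ hv0).1 (Nat.lt_floor_add_one ((μ + B) / v)).le
        rwa [add_mul, one_mul] at this
      have hdist : |μ - (-B + i * v)| ≤ v := by
        rw [abs_le]
        constructor <;> linarith
      have h1 : (∑ k, gridFn (j, i) (s k)) / n
          ≤ (∑ k, dualIntegrand φ L X l μ (s k)) / n + ε / 16 := by
        calc (∑ k, gridFn (j, i) (s k)) / n
            ≤ (∑ k, (dualIntegrand φ L X l μ (s k) + L * v)) / n := by
              gcongr with k _
              exact dualIntegrand_le_add hφ hL hl hj1 hdist (s k)
          _ = _ := by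
              rw [Finset.sum_add_distrib, hLv]
              simp only [Finset.sum_const, Finset.card_univ, Fintype.card_fin, nsmul_eq_mul]
              field_simp
      have h2 : ∫ ω, gridFn (j, i) ω ∂P < (∑ k, gridFn (j, i) (s k)) / n + ε / 16 :=
        not_le.1 (hs1 (j, i) hmem)
      have hjw : (0 : ℝ) ≤ j * w := by positivity
      have h3 : R ≤ ∫ ω, gridFn (j, i) ω ∂P + j * w * τ :=
        robustRisk_le_dual hφL hX hXB hτ hjw
          (fun ω => conjExcess_trunc_ne_top hφ hL hjw _)
          (integrable_dualIntegrand hφ hL hX hXB hB.le hjw (hμT _ hmem))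
      have h4 : j * w * τ ≤ l * τ + ε / 8 := by
        rw [← hwτ, ← add_mul]; gcongr
      have h5 : (∑ k, dualIntegrand φ L X l μ (s k)) / n + l * τ
          ≤ empiricalRisk (truncDivergence φ L) τ X s := hdual
      linarith
    · have h1 : empiricalRisk (truncDivergence φ L) τ X s ≤ (∑ k, f₀ (s k)) / n + l₀ * τ :=
        empiricalRisk_le hφL hX hn hτ s hl₀ fun k => conjExcess_trunc_ne_top hφ hL hl₀ _
      have h2 : (∑ k, f₀ (s k)) / n < ∫ ω, f₀ ω ∂P + ε / 16 := not_le.1 hs0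
      linarith

end Concentration

/-! ### The bias caused by truncation -/

section Truncation

variable {Ω : Type*} [MeasurableSpace Ω] {P : Measure Ω} [IsProbabilityMeasure P]
  {B τ η L : ℝ} {X ζ : Ω → ℝ} {φ : ℝ → ℝ≥0∞}

theorem exists_integral_excess_le (hi : Integrable ζ P) (hη : 0 < η) :
    ∃ l : ℝ, 1 ≤ l ∧ ∫ ω, max (ζ ω - l) 0 ∂P ≤ η := by
  have h : Filter.Tendsto (fun k : ℕ => ∫ ω, max (ζ ω - k) 0 ∂P) Filter.atTop
      (nhds (∫ _ω, (0 : ℝ) ∂P)) := by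
    refine tendsto_integral_of_dominated_convergence (fun ω => |ζ ω|)
      (fun k => (hi.sub (integrable_const _)).pos_part.aestronglyMeasurable) hi.abs
      (fun k => ae_of_all _ fun ω => ?_) (ae_of_all _ fun ω => ?_)
    · rw [Real.norm_of_nonneg (le_max_right _ _)]
      have := le_abs_self (ζ ω)
      have hk : (0 : ℝ) ≤ k := k.cast_nonneg
      exact max_le (by linarith) (abs_nonneg _)
    · refine tendsto_const_nhds.congr' ?_
      filter_upwards [Filter.eventually_ge_atTop ⌈ζ ω⌉₊] with k hk
      rw [max_eq_right (sub_nonpos.2 (Nat.ceil_le.1 hk))]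
  rw [integral_zero] at h
  obtain ⟨k, hk, hk1⟩ := ((h.eventually (gt_mem_nhds hη)).and
    (Filter.eventually_ge_atTop 1)).exists
  exact ⟨k, by exact_mod_cast hk1, hk.le⟩

/-- The set of levels is nonempty by dominated convergence, and the excess is `1`-Lipschitz in the
level, so the infimum is attained. -/
theorem truncLevel_spec (hi : Integrable ζ P) (hη : 0 < η) :
    1 ≤ truncLevel P ζ η ∧ ∫ ω, max (ζ ω - truncLevel P ζ η) 0 ∂P ≤ η := by
  have hne : {L : ℝ | 1 ≤ L ∧ ∫ ω, max (ζ ω - L) 0 ∂P ≤ η}.Nonempty :=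
    exists_integral_excess_le hi hη
  refine ⟨le_csInf hne fun _ h => h.1, le_of_forall_pos_le_add fun r hr => ?_⟩
  obtain ⟨l, hl, hlr⟩ := Real.lt_sInf_add_pos hne hr
  have hint : ∀ c : ℝ, Integrable (fun ω => max (ζ ω - c) 0) P := fun c =>
    (hi.sub (integrable_const c)).pos_part
  calc ∫ ω, max (ζ ω - truncLevel P ζ η) 0 ∂P ≤ ∫ ω, (max (ζ ω - l) 0 + r) ∂P := by
        refine integral_mono (hint _) ((hint l).add (integrable_const r)) fun ω => ?_
        have h1 := le_max_left (ζ ω - l) 0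
        have h2 := le_max_right (ζ ω - l) 0
        have h3 : l < truncLevel P ζ η + r := hlr
        exact max_le (by linarith) (by linarith)
    _ = ∫ ω, max (ζ ω - l) 0 ∂P + r := by rw [integral_add (hint l) (integrable_const r)]; simp
    _ ≤ η + r := by linarith [hl.2]

/-- Truncating a feasible density costs at most twice the truncated mass. -/
theorem integral_le_robustRisk_trunc (hφ : IsDivergence φ) (hX : Measurable X) (hB : 0 ≤ B)
    (hXB : ∀ ω, |X ω| ≤ B) (hL : 1 ≤ L) (hζ : ζ ∈ ambiguitySet φ τ P)
    (hη : ∫ ω, max (ζ ω - L) 0 ∂P ≤ η) :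
    ∫ ω, X ω * ζ ω ∂P ≤ robustRisk (truncDivergence φ L) τ P X + 2 * (B * η) := by
  have hm := hζ.1.measurable
  have hi := hζ.1.integrable
  set e : Ω → ℝ := fun ω => max (ζ ω - L) 0 with he
  have hei : Integrable e P := (hi.sub (integrable_const L)).pos_part
  have he0 : ∀ ω, 0 ≤ e ω := fun ω => le_max_right _ _
  have hmin : ∀ ω, min (ζ ω) L = ζ ω - e ω := fun ω => by
    simp only [he]
    rcases le_total (ζ ω) L with h | h
    · rw [min_eq_left h, max_eq_right (by linarith), sub_zero]
    · rw [min_eq_right h, max_eq_left (by linarith)]; ring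
  have hξi : Integrable (fun ω => ζ ω - e ω) P := hi.sub hei
  have hξ0 : ∀ ω, 0 ≤ ζ ω - e ω := fun ω => by
    rw [← hmin]; exact le_min (hζ.1.nonneg ω) (by linarith)
  have hφξ : ∀ ω, truncDivergence φ L (ζ ω - e ω) ≤ φ (ζ ω) := fun ω => by
    rw [truncDivergence_of_mem φ ⟨hξ0 ω, by rw [← hmin]; exact min_le_right _ _⟩, ← hmin]
    rcases le_total (ζ ω) L with h | h
    · rw [min_eq_left h]
    · rw [min_eq_right h]
      refine hφ.le_of_mem_uIcc ?_
      rw [Set.uIcc_of_ge (hL.trans h)]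
      exact ⟨hL, h⟩
  -- Apply the exact penalty to `min ζ L`, whose missing mass is `∫ e`. The penalty and the reward
  -- lost each cost at most `B ∫ e`, hence the factor `2`.
  have h1 := integral_le_robustRisk_add_penalty (hφ.trunc hL) hX hXB (by fun_prop) hξ0 hξi
    ((lintegral_mono hφξ).trans hζ.2)
  have h2 := abs_integral_mul_le hX hXB hei
  have he1 : 0 ≤ ∫ ω, e ω ∂P := integral_nonneg he0
  simp only [mul_sub, abs_of_nonneg (he0 _)] at h1 h2
  rw [integral_sub (integrable_mul_of_bounded hX hXB hi) (integrable_mul_of_bounded hX hXB hei),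
    integral_sub hi hei, hζ.1.integral_eq_one, sub_sub_cancel_left, abs_neg,
    abs_of_nonneg he1] at h1
  have h3 := mul_le_mul_of_nonneg_left hη hB
  linarith [(abs_le.1 h2).2]

end Truncation

/-! ### Assembly of truncation bias and sampling error -/

theorem mainTheorem11 {Ω : Type*} [MeasurableSpace Ω] (P : Measure Ω) [IsProbabilityMeasure P]
    (φ : ℝ → ℝ≥0∞) (hφ : IsDivergence φ) (τ : ℝ) (hτ : 0 < τ) (B : ℝ) (hB : 0 ≤ B)
    (X : Ω → ℝ) (hX : Measurable X) (hXB : ∀ ω, X ω ∈ Set.Icc (-B) B)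
    (ε : ℝ) (hε : 0 < ε)
    (ζ : Ω → ℝ) (hζ : IsNearOptimal φ τ P X (ε / 8) ζ)
    (η : ℝ) (hη : 0 < η) (hηB : B * η ≤ ε / 8)
    (L : ℝ) (hL : L = truncLevel P ζ η) :
    (∀ δ : ℝ, 0 < δ → δ < 1 → ∀ n : ℕ, 0 < n →
      128 * boundConst B L ^ 2 *
          Real.log (256 * B ^ 2 * lipConst B τ ε L ^ 2 / (τ * ε ^ 2 * δ)) / ε ^ 2 ≤ (n : ℝ) →
      1 - δ ≤ (Measure.pi (fun _ : Fin n => P)).real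
        {s | |robustRisk φ τ P X - empiricalRisk (truncDivergence φ L) τ X s| ≤ ε}) ∧
    (∀ n : ℕ, 0 < n →
      512 * boundConst B L ^ 2 *
          Real.log (8192 * B ^ 3 * lipConst B τ ε L ^ 2 / (τ * ε ^ 3)) / ε ^ 2 ≤ (n : ℝ) →
      Integrable (fun s : Fin n → Ω => empiricalRisk φ τ X s) (Measure.pi (fun _ : Fin n => P)) ∧
      robustRisk φ τ P X - ε ≤
        ∫ s : Fin n → Ω, empiricalRisk φ τ X s ∂(Measure.pi (fun _ : Fin n => P)) ∧
      ∫ s : Fin n → Ω, empiricalRisk φ τ X s ∂(Measure.pi (fun _ : Fin n => P)) ≤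
        robustRisk φ τ P X) := by
  have hXB' : ∀ ω, |X ω| ≤ B := fun ω => abs_le.2 (hXB ω)
  obtain ⟨hL1, hLη⟩ := truncLevel_spec hζ.1.1.integrable hη
  rw [← hL] at hL1 hLη
  have hφL := hφ.trunc hL1
  set R := robustRisk φ τ P X with hR
  set RL := robustRisk (truncDivergence φ L) τ P X with hRL
  have hRB := abs_le.1 (abs_robustRisk_le (P := P) (τ := τ) hφ hX hXB')
  rw [← hR] at hRB
  have hRL1 : RL ≤ R := robustRisk_mono hφL (le_truncDivergence φ L) hX hXB'
  have hRL2 : R - 3 * ε / 8 ≤ RL := by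
    -- Near-optimality loses `ε/8` and truncation `2Bη ≤ ε/4`.
    have h1 := integral_le_robustRisk_trunc hφ hX hB hXB' hL1 hζ.1 hLη
    have h2 := hζ.2
    linarith
  refine ⟨fun δ hδ0 _ n hn hnn => ?_, fun n hn hnn =>
    ⟨integrable_empiricalRisk hφ hX hn hτ hB hXB', ?_,
      integral_empiricalRisk_le hφ hX hn hτ hB hXB'⟩⟩
  · rcases lt_or_ge ε (2 * B) with hBε | hBε
    · obtain ⟨G, hGm, hG, hGs⟩ :=
        exists_concentration_event (P := P) hφ hτ hX hXB' hε hBε hL1 hδ0 hn hnn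
      have h1 : 1 - δ ≤ (Measure.pi fun _ : Fin n => P).real G := by
        have := probReal_compl_eq_one_sub (μ := Measure.pi fun _ : Fin n => P) hGm
        linarith
      refine h1.trans (measureReal_mono fun s hs => ?_)
      obtain ⟨h2, h3⟩ := hGs s hs
      have h4 : |R - empiricalRisk (truncDivergence φ L) τ X s| ≤ ε :=
        abs_le.2 ⟨by linarith, by linarith⟩
      exact h4
    · have h1 : {s : Fin n → Ω | |R - empiricalRisk (truncDivergence φ L) τ X s| ≤ ε}
          = Set.univ := by
        refine Set.eq_univ_of_forall fun s => ?_
        have h2 := abs_le.1 (abs_empiricalRisk_le (τ := τ) hφL hX hn hXB' s)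
        have h3 : |R - empiricalRisk (truncDivergence φ L) τ X s| ≤ ε :=
          abs_le.2 ⟨by linarith, by linarith⟩
        exact h3
      rw [h1, probReal_univ]
      linarith
  · have hbound := fun s : Fin n → Ω => abs_le.1 (abs_empiricalRisk_le (τ := τ) hφ hX hn hXB' s)
    have hint := integrable_empiricalRisk (P := P) hφ hX hn hτ hB hXB'
    rcases lt_or_ge ε (2 * B) with hBε | hBε
    · have hB0 : 0 < B := by linarith
      set A := 8192 * B ^ 3 * lipConst B τ ε L ^ 2 / (τ * ε ^ 3) with hA
      have hAδ : 256 * B ^ 2 * lipConst B τ ε L ^ 2 / (τ * ε ^ 2 * (ε / (32 * B))) = A := by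
        rw [hA]; field_simp; ring
      -- Makes the logarithm nonnegative, so that the factor `128` of the concentration bound may be
      -- enlarged to `512`.
      have hA1 : 1 ≤ A := by
        have h1 := card_grid_le hτ hε hBε hL1
        have h2 : A = 256 * B ^ 2 * lipConst B τ ε L ^ 2 / (τ * ε ^ 2) * (32 * B / ε) := by
          rw [hA]; field_simp; ring
        have h3 : 1 ≤ 32 * B / ε := by rw [le_div_iff₀ hε]; linarith
        have h4 : 0 ≤ (16 * B / ε + 2) * (32 * B * L / ε + 1) := by positivity
        rw [h2]
        exact one_le_mul_of_one_le_of_one_le (by linarith) h3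
      have hlog : 0 ≤ Real.log A := Real.log_nonneg hA1
      obtain ⟨G, hGm, hG, hGs⟩ :=
        exists_concentration_event (P := P) (δ := ε / (32 * B)) hφ hτ hX hXB' hε hBε hL1
          (by positivity) hn (by
            rw [hAδ]
            refine le_trans ?_ hnn
            gcongr
            norm_num)
      -- On `G` the loss is `3ε/8 + ε/4`, because the risk for `φ` dominates that for `φ_L`; off `G`
      -- the bound `2B` is trivial and contributes at most `ε/16` on average.
      have hpt : ∀ s : Fin n → Ω,
          R - 5 * ε / 8 - Gᶜ.indicator (fun _ => 2 * B) s ≤ empiricalRisk φ τ X s := by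
        intro s
        by_cases hs : s ∈ G
        · have h1 : empiricalRisk (truncDivergence φ L) τ X s ≤ empiricalRisk φ τ X s := by
            have := isProbabilityMeasure_empiricalDist hn s
            exact robustRisk_mono hφL (le_truncDivergence φ L) hX hXB'
          rw [Set.indicator_of_notMem (by simpa using hs)]
          linarith [(hGs s hs).1]
        · rw [Set.indicator_of_mem (by simpa using hs)]
          linarith [(hbound s).1]
      have hind : Integrable (Gᶜ.indicator fun _ => 2 * B) (Measure.pi fun _ : Fin n => P) :=
        (integrable_const _).indicator hGm.compl
      have h1 := integral_mono ((integrable_const (R - 5 * ε / 8)).sub hind) hint hpt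
      rw [integral_sub' (integrable_const _) hind, integral_indicator_const _ hGm.compl] at h1
      simp only [integral_const, probReal_univ, smul_eq_mul, one_mul] at h1
      have h2 : (Measure.pi fun _ : Fin n => P).real Gᶜ * (2 * B) ≤ ε / 16 := by
        calc (Measure.pi fun _ : Fin n => P).real Gᶜ * (2 * B) ≤ ε / (32 * B) * (2 * B) := by
              gcongr
          _ = ε / 16 := by field_simp; ring
      linarith
    · have h1 := integral_mono (integrable_const (-B)) hint fun s => (hbound s).1
      simp only [integral_const, probReal_univ, smul_eq_mul, one_mul] at h1
      linarith
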